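/- Let $n$ be a positive integer and $\mathbb S=\mathbb C[q,q^{-1}]$, where $q$ is an indeterminate. The tied--boxed Hecke algebra $bH_n(q)$ is the associative unital $\mathbb S$-algebra presented by generators $e_1,\dots,e_{n-1},z_1,\dots,z_{n-1}$ and the relations $$e_i^2=e_i,\quad e_ie_j=e_je_i,\quad e_iz_i=z_i,\quad e_iz_j=z_je_i,\quad z_i^2=e_i+(q-q^{-1})z_i\qquad(\text{all } i,j),$$ $$z_iz_jz_i=z_jz_iz_j\ \ (|i-j|=1),\qquad z_iz_j=z_jz_i\ \ (|i-j|>1).$$ The algebra of braids and ties $\mathcal E_n(q)$ is the $\mathbb S$-algebra presented by generators $e_1,\dots,e_{n-1},g_1,\dots,g_{n-1}$ and the relations $e_i^2=e_i$, $e_ie_j=e_je_i$, $g_ie_i=e_ig_i$, $g_i^2=1+(q-q^{-1})e_ig_i$ for all $i,j$; $g_ig_j=g_jg_i$ and $g_ie_j=e_jg_i$ for $|i-j|>1$; and $g_ig_jg_i=g_jg_ig_j$, $e_ig_jg_i=g_jg_ie_j$, $e_ie_jg_j=e_ig_je_i=g_je_ie_j$ for $|i-j|=1$. A set partition $\mathbf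 I$ of $[n]=\{1,\dots,n\}$ is linear if each of its blocks is an interval; let $\mathcal{LP}_n$ be the set of linear set partitions of $[n]$. For $\mathbf I\in\mathcal{LP}_n$ let $\|\mathbf I\|$ be the composition of $n$ formed by the sizes of the blocks of $\mathbf I$ listed by increasing minimum, and put $E_{\mathbf I}=\prod_{i\sim_{\mathbf I}i+1}e_i\in bH_n(q)$. For a composition $\mu=(\mu_1,\dots,\mu_k)$ of $n$ (all parts positive) let $S_\mu\le S_n$ be its Young subgroup, that is, the group of permutations preserving each of the consecutive intervals of lengths $\mu_1,\dots,\mu_k$ in $[n]$. For $w\in S_n$ put $z_w=z_{i_1}\cdots z_{i_k}\in bH_n(q)$, where $s_{i_1}\cdots s_{i_k}$ is a reduced expression of $w$ in the simple transpositions $s_i=(i,i+1)$. Then: 1. The elements $z_w$ do not depend on the choice of the reduced expressions, and $bH_n(q)$ is a free $\mathbb S$-module with basis $E_{\mathbf I}z_w$, indexed by the pairs $(\mathbf I,w)$ with $\mathbf I\in\mathcal{LP}_n$ and $w\in S_{\|\mathbf I\|}$. 2. The $\mathbb S$-module $bH_n(q)$ has finite rank $$\dim bH_n(q)=\sum_{(\mu_1,\dots,\mu_k)}\mu_1!\cdots\mu_k!,$$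 where the sum runs over all compositions of $n$ with positive parts. 3. There is an injective homomorphism of $\mathbb S$-algebras $\iota_1:bH_n(q)\to\mathcal E_n(q)$ with $\iota_1(e_i)=e_i$ and $\iota_1(z_i)=e_ig_i$ for all $i$. 4. Let $r\ge n$ and let $V$ be the free $\mathbb S$-module with basis $\{v_i^a\mid i\in[n],\,a\in[r]\}$. Let $\mathbf E,\mathbf G$ be the operators on $V\otimes V$ (written on the right) with $$(v_i^a\otimes v_j^b)\mathbf E=\begin{cases}v_i^a\otimes v_j^b&a=b,\\0&a\ne b,\end{cases}\qquad (v_i^a\otimes v_j^b)\mathbf G=\begin{cases}v_j^b\otimes v_i^a&a\neq b,\\ q\,v_i^a\otimes v_j^b&a=b,\ i=j,\\ v_j^b\otimes v_i^a&a=b,\ i>j,\\ (q-q^{-1})\,v_i^a\otimes v_j^b+v_j^b\otimes v_i^a&a=b,\ i<j,\end{cases}$$ and let $\mathbf E_i,\mathbf G_i$ be the operators on $V^{\otimes n}$ given by $\mathbf E,\mathbf G$ acting on the $i$th and $(i+1)$th factors. Then there is a faithful representation of $bH_n(q)$ on $V^{\otimes n}$, by operators acting on the right, with $e_i\mapsto\mathbf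 E_i$ and $z_i\mapsto\mathbf E_i\mathbf G_i$ for all $i$. -/

import Mathlib

open scoped TensorProduct

noncomputable section

namespace TiedBoxed

/-- The ground ring `𝕊 = ℂ[q, q⁻¹]` of Laurent polynomials in the indeterminate `q`. -/
abbrev GroundRing : Type := LaurentPolynomial ℂ

/-- The indeterminate `q`. -/
def q : GroundRing := LaurentPolynomial.T 1

/-- The element `q⁻¹`. -/
def qInv : GroundRing := LaurentPolynomial.T (-1)

/-- Indices `i, j` with `|i - j| = 1`. -/
def Adjacent {m : ℕ} (i j : Fin m) : Prop := |((i : ℕ) : ℤ) - ((j : ℕ) : ℤ)| = 1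

/-- Indices `i, j` with `|i - j| > 1`. -/
def Far {m : ℕ} (i j : Fin m) : Prop := 1 < |((i : ℕ) : ℤ) - ((j : ℕ) : ℤ)|

/-! ### The tied-boxed Hecke algebra -/

/-- The generators `e_1, …, e_{n-1}, z_1, …, z_{n-1}` (indexed by `Fin (n - 1)`). -/
inductive BHGen (n : ℕ) : Type
  | e (i : Fin (n - 1)) : BHGen n
  | z (i : Fin (n - 1)) : BHGen n

namespace BHGen

/-- The generator `e_i` in the free algebra. -/
def E {n : ℕ} (i : Fin (n - 1)) : FreeAlgebra GroundRing (BHGen n) :=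
  FreeAlgebra.ι GroundRing (BHGen.e i)

/-- The generator `z_i` in the free algebra. -/
def Z {n : ℕ} (i : Fin (n - 1)) : FreeAlgebra GroundRing (BHGen n) :=
  FreeAlgebra.ι GroundRing (BHGen.z i)

end BHGen

open BHGen in
/-- The defining relations of the tied-boxed Hecke algebra. -/
inductive BHRel (n : ℕ) :
    FreeAlgebra GroundRing (BHGen n) → FreeAlgebra GroundRing (BHGen n) → Prop
  | e_sq (i : Fin (n - 1)) : BHRel n (E i * E i) (E i)
  | e_comm (i j : Fin (n - 1)) : BHRel n (E i * E j) (E j * E i)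
  | z_braid (i j : Fin (n - 1)) (h : Adjacent i j) :
      BHRel n (Z i * Z j * Z i) (Z j * Z i * Z j)
  | z_comm (i j : Fin (n - 1)) (h : Far i j) : BHRel n (Z i * Z j) (Z j * Z i)
  | e_mul_z (i : Fin (n - 1)) : BHRel n (E i * Z i) (Z i)
  | e_z_comm (i j : Fin (n - 1)) : BHRel n (E i * Z j) (Z j * E i)
  | z_sq (i : Fin (n - 1)) : BHRel n (Z i * Z i) (E i + (q - qInv) • Z i)

/-- The tied-boxed Hecke algebra `bH_n(q)`, as the `𝕊`-algebra with the presentation above. -/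
abbrev BoxedHecke (n : ℕ) : Type := RingQuot (BHRel n)

/-- The generator `e_i` of `bH_n(q)`. -/
def bhE {n : ℕ} (i : Fin (n - 1)) : BoxedHecke n :=
  RingQuot.mkAlgHom GroundRing (BHRel n) (BHGen.E i)

/-- The generator `z_i` of `bH_n(q)`. -/
def bhZ {n : ℕ} (i : Fin (n - 1)) : BoxedHecke n :=
  RingQuot.mkAlgHom GroundRing (BHRel n) (BHGen.Z i)

/-! ### The algebra of braids and ties -/

/-- The generators `e_1, …, e_{n-1}, g_1, …, g_{n-1}` (indexed by `Fin (n - 1)`). -/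
inductive BTGen (n : ℕ) : Type
  | e (i : Fin (n - 1)) : BTGen n
  | g (i : Fin (n - 1)) : BTGen n

namespace BTGen

/-- The generator `e_i` in the free algebra. -/
def E {n : ℕ} (i : Fin (n - 1)) : FreeAlgebra GroundRing (BTGen n) :=
  FreeAlgebra.ι GroundRing (BTGen.e i)

/-- The generator `g_i` in the free algebra. -/
def G {n : ℕ} (i : Fin (n - 1)) : FreeAlgebra GroundRing (BTGen n) :=
  FreeAlgebra.ι GroundRing (BTGen.g i)

end BTGen

open BTGen in
/-- The defining relations of the algebra of braids and ties. -/
inductive BTRel (n : ℕ) :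
    FreeAlgebra GroundRing (BTGen n) → FreeAlgebra GroundRing (BTGen n) → Prop
  | e_sq (i : Fin (n - 1)) : BTRel n (E i * E i) (E i)
  | e_comm (i j : Fin (n - 1)) : BTRel n (E i * E j) (E j * E i)
  | g_braid (i j : Fin (n - 1)) (h : Adjacent i j) :
      BTRel n (G i * G j * G i) (G j * G i * G j)
  | g_comm (i j : Fin (n - 1)) (h : Far i j) : BTRel n (G i * G j) (G j * G i)
  | g_e_comm (i : Fin (n - 1)) : BTRel n (G i * E i) (E i * G i)
  | g_e_comm_far (i j : Fin (n - 1)) (h : Far i j) : BTRel n (G i * E j) (E j * G i)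
  | e_g_g (i j : Fin (n - 1)) (h : Adjacent i j) :
      BTRel n (E i * G j * G i) (G j * G i * E j)
  | e_e_g (i j : Fin (n - 1)) (h : Adjacent i j) :
      BTRel n (E i * E j * G j) (E i * G j * E i)
  | e_g_e (i j : Fin (n - 1)) (h : Adjacent i j) :
      BTRel n (E i * G j * E i) (G j * E i * E j)
  | g_sq (i : Fin (n - 1)) : BTRel n (G i * G i) (1 + (q - qInv) • (E i * G i))

/-- The algebra of braids and ties `𝓔_n(q)`, as the `𝕊`-algebra with the presentation above. -/
abbrev BraidsTies (n : ℕ) : Type := RingQuot (BTRel n)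

/-- The generator `e_i` of `𝓔_n(q)`. -/
def btE {n : ℕ} (i : Fin (n - 1)) : BraidsTies n :=
  RingQuot.mkAlgHom GroundRing (BTRel n) (BTGen.E i)

/-- The generator `g_i` of `𝓔_n(q)`. -/
def btG {n : ℕ} (i : Fin (n - 1)) : BraidsTies n :=
  RingQuot.mkAlgHom GroundRing (BTRel n) (BTGen.G i)

/-! ### Reduced expressions and the elements `z_w` -/

/-- The `i`-th point of `[n]`, for `i ∈ [n - 1]`. -/
def lo {n : ℕ} (i : Fin (n - 1)) : Fin n := ⟨i, by omega⟩

/-- The `(i + 1)`-st point of `[n]`, for `i ∈ [n - 1]`. -/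
def hi {n : ℕ} (i : Fin (n - 1)) : Fin n := ⟨i + 1, by omega⟩

/-- The simple transposition `s_i = (i, i + 1)`. -/
def simpleSwap {n : ℕ} (i : Fin (n - 1)) : Equiv.Perm (Fin n) := Equiv.swap (lo i) (hi i)

/-- `l = [i_1, …, i_k]` is a reduced expression of `w`: `w = s_{i_1} ⋯ s_{i_k}`, and no shorter
word in the simple transpositions has product `w`. -/
def IsReducedExpr {n : ℕ} (w : Equiv.Perm (Fin n)) (l : List (Fin (n - 1))) : Prop :=
  (l.map simpleSwap).prod = w ∧
    ∀ l' : List (Fin (n - 1)), (l'.map simpleSwap).prod = w → l.length ≤ l'.length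

theorem exists_expr {n : ℕ} (w : Equiv.Perm (Fin n)) :
    ∃ l : List (Fin (n - 1)), (l.map simpleSwap).prod = w := by
  cases n with
  | zero => exact ⟨[], Subsingleton.elim _ _⟩
  | succ m =>
    have hw : w ∈ Submonoid.closure
        (Set.range fun i : Fin m ↦ Equiv.swap i.castSucc i.succ) := by
      rw [Equiv.Perm.mclosure_swap_castSucc_succ]; trivial
    induction hw using Submonoid.closure_induction with
    | mem x hx =>
      obtain ⟨i, rfl⟩ := hx
      exact ⟨[i], by simp [simpleSwap, lo, hi]; rfl⟩
    | one => exact ⟨[], rfl⟩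
    | mul x y _ _ hx hy =>
      obtain ⟨l, hl⟩ := hx
      obtain ⟨l', hl'⟩ := hy
      exact ⟨l ++ l', by rw [List.map_append, List.prod_append, hl, hl']⟩

theorem exists_isReducedExpr {n : ℕ} (w : Equiv.Perm (Fin n)) :
    ∃ l : List (Fin (n - 1)), IsReducedExpr w l := by
  have h := exists_expr w
  refine ⟨Function.argminOn List.length
    {l : List (Fin (n - 1)) | (l.map simpleSwap).prod = w} h, ?_, ?_⟩
  · exact Function.argminOn_mem List.length
      {l : List (Fin (n - 1)) | (l.map simpleSwap).prod = w} h
  · intro l' hl'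
    exact Function.argminOn_le List.length
      {l : List (Fin (n - 1)) | (l.map simpleSwap).prod = w} hl'

/-- The element `z_{i_1} ⋯ z_{i_k}` of `bH_n(q)` attached to a word `[i_1, …, i_k]`. -/
def bhZWord {n : ℕ} (l : List (Fin (n - 1))) : BoxedHecke n := (l.map bhZ).prod

/-- The element `z_w = z_{i_1} ⋯ z_{i_k}`, where `s_{i_1} ⋯ s_{i_k}` is a reduced expression
of `w`; that the choice of the reduced expression is immaterial is part of the theorem. -/
def bhZPerm {n : ℕ} (w : Equiv.Perm (Fin n)) : BoxedHecke n :=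
  bhZWord (exists_isReducedExpr w).choose

/-! ### Linear set partitions, compositions, Young subgroups and the elements `E_I` -/

/-- Set partitions of `[n]`. -/
abbrev SetPartition (n : ℕ) : Type := Finpartition (Finset.univ : Finset (Fin n))

/-- Linear set partitions of `[n]`: every block is an interval. -/
def LinearSetPartition (n : ℕ) : Type :=
  {I : SetPartition n // ∀ B ∈ I.parts, Set.OrdConnected (B : Set (Fin n))}

/-- The elements of `[n]` that are the minimum of their block, in increasing order. -/
def blockMins {n : ℕ} (I : SetPartition n) : List (Fin n) :=
  (List.finRange n).filter fun i ↦ ∀ j ∈ I.part i, i ≤ j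

/-- The composition `‖I‖ = (|I_1|, …, |I_k|)`, where the blocks of `I` are listed by increasing
minimum. -/
def blockSizes {n : ℕ} (I : SetPartition n) : Composition n where
  blocks := (blockMins I).map fun i ↦ (I.part i).card
  blocks_pos := by
    intro k hk
    obtain ⟨i, -, rfl⟩ := List.mem_map.1 hk
    exact Finset.card_pos.2 ⟨i, I.mem_part (Finset.mem_univ i)⟩
  blocks_sum := by
    have hnd : (blockMins I).Nodup := (List.nodup_finRange n).filter _
    rw [← List.sum_toFinset _ hnd]
    have hp := I.sum_card_parts
    rw [Finset.card_univ, Fintype.card_fin] at hp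
    refine Eq.trans (Finset.sum_bij (fun i _ ↦ I.part i) ?_ ?_ ?_ ?_) hp
    · intro i _
      exact I.part_mem.2 (Finset.mem_univ i)
    · intro i hi j hj hij
      have hi' : ∀ k ∈ I.part i, i ≤ k := by simpa [blockMins] using hi
      have hj' : ∀ k ∈ I.part j, j ≤ k := by simpa [blockMins] using hj
      have h1 : i ≤ j := hi' j (by
        have := I.mem_part (Finset.mem_univ j)
        rwa [← hij] at this)
      have h2 : j ≤ i := hj' i (by
        have := I.mem_part (Finset.mem_univ i)
        rwa [hij] at this)
      exact le_antisymm h1 h2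
    · intro B hB
      have hne := I.nonempty_of_mem_parts hB
      have hpart : I.part (B.min' hne) = B := I.part_eq_of_mem hB (B.min'_mem hne)
      refine ⟨B.min' hne, ?_, hpart⟩
      have : ∀ k ∈ I.part (B.min' hne), B.min' hne ≤ k := by
        rw [hpart]
        exact fun k hk ↦ B.min'_le k hk
      simpa [blockMins] using this
    · intro i _
      rfl

/-- The Young subgroup `S_μ` of a composition `μ` of `n`: the permutations of `[n]` that preserve
each of the consecutive intervals of lengths `μ_1, …, μ_k` (the rows of the initial tableau). -/
def youngSubgroup {n : ℕ} (μ : Composition n) : Subgroup (Equiv.Perm (Fin n)) where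
  carrier := {w | ∀ i, μ.index (w i) = μ.index i}
  mul_mem' := by
    intro v w hv hw i
    exact (hv (w i)).trans (hw i)
  one_mem' := fun _ ↦ rfl
  inv_mem' := by
    intro w hw i
    have h := hw (w⁻¹ i)
    rw [← Equiv.Perm.mul_apply, mul_inv_cancel, Equiv.Perm.one_apply] at h
    exact h.symm

/-- The element `E_I = ∏_{i ∼_I i + 1} e_i` of `bH_n(q)` (the factors commute). -/
def bhEPart {n : ℕ} (I : SetPartition n) : BoxedHecke n :=
  (((List.finRange (n - 1)).filter fun i ↦ hi i ∈ I.part (lo i)).map bhE).prod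

/-! ### The tensor space representation -/

/-- The free module `V` with basis `v_i^a`, `i ∈ [n]`, `a ∈ [r]`. -/
abbrev ColoredSpace (n r : ℕ) : Type := (Fin n × Fin r) →₀ GroundRing

/-- The basis `v_i^a` of `V`. -/
def vBasis (n r : ℕ) : Module.Basis (Fin n × Fin r) GroundRing (ColoredSpace n r) :=
  Finsupp.basisSingleOne

/-- The vector `v_x ⊗ v_y` of `V ⊗ V`. -/
def vPair {n r : ℕ} (x y : Fin n × Fin r) :
    ColoredSpace n r ⊗[GroundRing] ColoredSpace n r :=
  vBasis n r x ⊗ₜ[GroundRing] vBasis n r y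

/-- The operator `𝐄` on `V ⊗ V`. -/
def opE (n r : ℕ) : Module.End GroundRing (ColoredSpace n r ⊗[GroundRing] ColoredSpace n r) :=
  ((vBasis n r).tensorProduct (vBasis n r)).constr GroundRing fun p ↦
    if p.1.2 = p.2.2 then vPair p.1 p.2 else 0

/-- The operator `𝐆` on `V ⊗ V`: it swaps the factors if the colours `a`, `b` differ, and is the
usual Hecke operator if they agree. -/
def opG (n r : ℕ) : Module.End GroundRing (ColoredSpace n r ⊗[GroundRing] ColoredSpace n r) :=
  ((vBasis n r).tensorProduct (vBasis n r)).constr GroundRing fun p ↦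
    if p.1.2 ≠ p.2.2 then vPair p.2 p.1
    else if p.1.1 = p.2.1 then q • vPair p.1 p.2
    else if p.2.1 < p.1.1 then vPair p.2 p.1
    else (q - qInv) • vPair p.1 p.2 + vPair p.2 p.1

/-- The tensor space `V^{⊗ n}`. -/
abbrev TensorSpace (n r : ℕ) : Type := ⨂[GroundRing] _ : Fin n, ColoredSpace n r

/-- The basis of `V^{⊗ n}` formed by the pure tensors `v_{f 1} ⊗ ⋯ ⊗ v_{f n}`. -/
def tensorBasis (n r : ℕ) :
    Module.Basis (Fin n → Fin n × Fin r) GroundRing (TensorSpace n r) :=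
  Basis.piTensorProduct fun _ ↦ vBasis n r

/-- The linear map `V ⊗ V → V^{⊗ n}` inserting a tensor in the factors `i`, `i + 1`, the other
factors being the basis vectors prescribed by `f`. -/
def insertPair {n r : ℕ} (i : Fin (n - 1)) (f : Fin n → Fin n × Fin r) :
    (ColoredSpace n r ⊗[GroundRing] ColoredSpace n r) →ₗ[GroundRing] TensorSpace n r :=
  ((vBasis n r).tensorProduct (vBasis n r)).constr GroundRing fun p ↦
    tensorBasis n r (Function.update (Function.update f (lo i) p.1) (hi i) p.2)

/-- The operator on `V^{⊗ n}` given by letting `F` act on the factors `i`, `i + 1`. -/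
def actAt {n r : ℕ} (i : Fin (n - 1))
    (F : Module.End GroundRing (ColoredSpace n r ⊗[GroundRing] ColoredSpace n r)) :
    Module.End GroundRing (TensorSpace n r) :=
  (tensorBasis n r).constr GroundRing fun f ↦ insertPair i f (F (vPair (f (lo i)) (f (hi i))))

end TiedBoxed

end

/-!
The ties `e_i` are central idempotents of `bH_n(q)`, and `z_i = e_i z_i`; so the algebra is
spanned by products `E_J z_w`, where `J` is a set of indices of ties and `w` moves points only
inside the blocks cut out by `J`. Two ingredients turn this into a basis.

*Spanning.* By Matsumoto's theorem for the symmetric group (`prod_map_eq_of_isReducedExpr`, proved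
by induction on the length, which is the number of inversions) the product `z_w` does not depend
on the reduced word. Multiplying `E_J z_w` by `z_i` gives either `E_{J ∪ i} z_{w s_i}` or, by the
quadratic relation, a combination of `E_{J ∪ i} z_{w s_i}` and `E_{J ∪ i} z_w`
(`mul_bhZ_mem_span`).

*Independence.* The algebra of braids and ties acts on the tensor space (`btRep`), and `e_i ↦ e_i`,
`z_i ↦ e_i g_i` defines a homomorphism `bhToBT` into it, so `bH_n(q)` acts too (`bhRep`). Fix `J` and
take the basis tensor with colours constant exactly on the blocks of `J` (this needs at most `n`
colours) and with decreasing indices. It is killed by `E_I` unless `I` is finer than `J`, and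
otherwise `E_I z_w` merely permutes its factors by `w` (`bhRep_boxedFamily_apply`): along a reduced
word each `z_i` meets indices in decreasing order. Distinct `w` give distinct basis tensors, so an
induction on the size of `J` shows that a combination of the `E_I z_w` that acts by zero is
trivial (`eq_zero_of_bhRep_sum_eq_zero`). This gives at once the basis, the faithfulness of the
tensor representation, and the injectivity of `bhToBT`, through which that representation factors.

*Counting.* Linear set partitions correspond to subsets `J` of the `n - 1` pairs of neighbours and,
by taking block sizes, to compositions of `n` (`blockSizes_bijective`); the Young subgroup of `μ` is
the stabilizer of the block function, of order `∏ μ_i!`.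
-/

open scoped TensorProduct

noncomputable section

namespace TiedBoxed

variable {n r : ℕ}

/-! ### Reduced words in the symmetric group -/

lemma lo_lt_hi (i : Fin (n - 1)) : lo i < hi i := Nat.lt_succ_self _

lemma simpleSwap_lo (i : Fin (n - 1)) : simpleSwap i (lo i) = hi i := Equiv.swap_apply_left _ _

lemma simpleSwap_hi (i : Fin (n - 1)) : simpleSwap i (hi i) = lo i := Equiv.swap_apply_right _ _

lemma simpleSwap_mul_self (i : Fin (n - 1)) : simpleSwap i * simpleSwap i = 1 :=
  Equiv.swap_mul_self _ _

lemma simpleSwap_simpleSwap (i : Fin (n - 1)) (a : Fin n) :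
    simpleSwap i (simpleSwap i a) = a := Equiv.swap_apply_self _ _ _

lemma simpleSwap_apply (i : Fin (n - 1)) (a : Fin n) :
    simpleSwap i a = if (a : ℕ) = i then hi i else if (a : ℕ) = i + 1 then lo i else a := by
  simp [simpleSwap, Equiv.swap_apply_def, lo, hi, Fin.ext_iff]

lemma simpleSwap_lo_of_far {i j : Fin (n - 1)} (h : Far i j) : simpleSwap i (lo j) = lo j := by
  unfold Far at h
  rw [lt_abs] at h
  rw [simpleSwap_apply, if_neg, if_neg] <;> simp [lo] <;> omega

lemma simpleSwap_hi_of_far {i j : Fin (n - 1)} (h : Far i j) : simpleSwap i (hi j) = hi j := by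
  unfold Far at h
  rw [lt_abs] at h
  rw [simpleSwap_apply, if_neg, if_neg] <;> simp [hi] <;> omega

lemma Far.symm {m : ℕ} {i j : Fin m} (h : Far i j) : Far j i := by
  unfold Far at *; rwa [abs_sub_comm]

lemma Adjacent.symm {m : ℕ} {i j : Fin m} (h : Adjacent i j) : Adjacent j i := by
  unfold Adjacent at *; rwa [abs_sub_comm]

lemma eq_or_adjacent_or_far {m : ℕ} (i j : Fin m) : i = j ∨ Adjacent i j ∨ Far i j := by
  unfold Adjacent Far
  rw [Fin.ext_iff]
  rcases abs_cases ((i : ℕ) - (j : ℕ) : ℤ) with h | h <;> omega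

lemma Adjacent.hi_eq_lo_or {i j : Fin (n - 1)} (h : Adjacent i j) :
    hi i = lo j ∨ hi j = lo i := by
  unfold Adjacent at h
  simp only [lo, hi, Fin.ext_iff]
  rcases abs_cases ((i : ℕ) - (j : ℕ) : ℤ) with h | h <;> omega

lemma simpleSwap_comm {i j : Fin (n - 1)} (h : Far i j) :
    simpleSwap i * simpleSwap j = simpleSwap j * simpleSwap i := by
  have := Equiv.mul_swap_eq_swap_mul (simpleSwap i) (lo j) (hi j)
  rwa [simpleSwap_lo_of_far h, simpleSwap_hi_of_far h] at this

lemma simpleSwap_lo_of_hi_eq_lo {i j : Fin (n - 1)} (h : hi i = lo j) :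
    simpleSwap j (lo i) = lo i := by
  simp only [lo, hi, Fin.ext_iff] at h
  rw [simpleSwap_apply, if_neg, if_neg] <;> simp [lo] <;> omega

lemma simpleSwap_hi_of_hi_eq_lo {i j : Fin (n - 1)} (h : hi i = lo j) :
    simpleSwap i (hi j) = hi j := by
  simp only [lo, hi, Fin.ext_iff] at h
  rw [simpleSwap_apply, if_neg, if_neg] <;> simp [hi] <;> omega

lemma simpleSwap_lo_eq_lo_of_hi_eq_lo {i j : Fin (n - 1)} (h : hi i = lo j) :
    simpleSwap i (lo j) = lo i := by
  rw [← h, simpleSwap_hi]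

lemma simpleSwap_braid_of_hi_eq_lo {i j : Fin (n - 1)} (h : hi i = lo j) :
    simpleSwap i * simpleSwap j * simpleSwap i = simpleSwap j * simpleSwap i * simpleSwap j := by
  have h1 := Equiv.mul_swap_eq_swap_mul (simpleSwap i * simpleSwap j) (lo i) (hi i)
  have h2 : (simpleSwap i * simpleSwap j) (lo i) = lo j := by
    rw [Equiv.Perm.mul_apply, simpleSwap_lo_of_hi_eq_lo h, simpleSwap_lo, h]
  have h3 : (simpleSwap i * simpleSwap j) (hi i) = hi j := by
    rw [Equiv.Perm.mul_apply, h, simpleSwap_lo, simpleSwap_hi_of_hi_eq_lo h]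
  rw [h2, h3] at h1
  exact h1

/-- The pairs of positions whose values are in the wrong order; their number is the length
of `w`. -/
def inversions (w : Equiv.Perm (Fin n)) : Finset (Fin n × Fin n) :=
  Finset.univ.filter fun p ↦ p.1 < p.2 ∧ w p.2 < w p.1

lemma mem_inversions {w : Equiv.Perm (Fin n)} {p : Fin n × Fin n} :
    p ∈ inversions w ↔ p.1 < p.2 ∧ w p.2 < w p.1 := by
  simp [inversions]

lemma card_inversions_mul_of_lt {w : Equiv.Perm (Fin n)} {i : Fin (n - 1)}
    (h : w (lo i) < w (hi i)) :
    (inversions (w * simpleSwap i)).card = (inversions w).card + 1 := by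
  have key : inversions (w * simpleSwap i) = insert (lo i, hi i)
      ((inversions w).map (Equiv.prodCongr (simpleSwap i) (simpleSwap i)).toEmbedding) := by
    ext ⟨a, b⟩
    have hs : (simpleSwap i).symm = simpleSwap i := Equiv.symm_swap _ _
    simp only [mem_inversions, Finset.mem_insert, Finset.mem_map_equiv,
      Equiv.Perm.mul_apply, Equiv.prodCongr_symm, hs, Equiv.prodCongr_apply, Prod.map_apply, Prod.mk.injEq]
    by_cases h1 : a = lo i ∧ b = hi i
    · obtain ⟨rfl, rfl⟩ := h1
      simp [simpleSwap_lo, simpleSwap_hi, h, lo_lt_hi]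
    · by_cases h2 : a = hi i ∧ b = lo i
      · obtain ⟨rfl, rfl⟩ := h2
        simp [simpleSwap_lo, simpleSwap_hi, h.not_gt, (lo_lt_hi i).not_gt, (lo_lt_hi i).ne']
      · have h3 : a < b ↔ simpleSwap i a < simpleSwap i b := by
          simp only [simpleSwap_apply, lo, hi, Fin.ext_iff] at h1 h2 ⊢
          split_ifs <;> simp only [Fin.lt_def] <;> omega
        rw [← h3]
        simp [h1]
  rw [key, Finset.card_insert_of_notMem, Finset.card_map]
  have hs : (simpleSwap i).symm = simpleSwap i := Equiv.symm_swap _ _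
  simp [mem_inversions, Finset.mem_map_equiv, hs, simpleSwap_lo, simpleSwap_hi,
    (lo_lt_hi i).not_gt]

lemma card_inversions_mul_of_gt {w : Equiv.Perm (Fin n)} {i : Fin (n - 1)}
    (h : w (hi i) < w (lo i)) :
    (inversions (w * simpleSwap i)).card + 1 = (inversions w).card := by
  have := card_inversions_mul_of_lt (w := w * simpleSwap i) (i := i)
    (by simpa [simpleSwap_lo, simpleSwap_hi] using h)
  rw [← this, mul_assoc, simpleSwap_mul_self, mul_one]

lemma apply_lo_lt_or_gt (w : Equiv.Perm (Fin n)) (i : Fin (n - 1)) :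
    w (lo i) < w (hi i) ∨ w (hi i) < w (lo i) :=
  lt_or_gt_of_ne (w.injective.ne (lo_lt_hi i).ne)

lemma inversions_one : inversions (1 : Equiv.Perm (Fin n)) = ∅ := by
  ext ⟨a, b⟩
  simpa [mem_inversions] using fun h : a < b ↦ h.le

lemma card_inversions_prod_le (l : List (Fin (n - 1))) :
    (inversions (l.map simpleSwap).prod).card ≤ l.length := by
  induction l using List.reverseRecOn with
  | nil => simp [inversions_one]
  | append_singleton l i ih =>
    rw [List.map_append, List.prod_append, List.map_singleton, List.prod_singleton]
    rcases apply_lo_lt_or_gt (l.map simpleSwap).prod i with h | h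
    · simp [card_inversions_mul_of_lt h, ih]
    · have := card_inversions_mul_of_gt h
      simp only [List.length_append, List.length_singleton]
      omega

lemma exists_descent {w : Equiv.Perm (Fin n)} (hw : w ≠ 1) :
    ∃ i : Fin (n - 1), w (hi i) < w (lo i) := by
  by_contra! h
  refine hw ?_
  cases n with
  | zero => exact Subsingleton.elim _ _
  | succ m =>
    have hm : StrictMono w := Fin.strictMono_iff_lt_succ.2 fun i ↦
      (apply_lo_lt_or_gt w i).resolve_right (h i).not_gt
    ext a : 1
    exact congrFun (hm.range_inj strictMono_id |>.1 (by simp [w.surjective.range_eq])) a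

lemma exists_word_length_eq (w : Equiv.Perm (Fin n)) :
    ∃ l : List (Fin (n - 1)),
      (l.map simpleSwap).prod = w ∧ l.length = (inversions w).card := by
  induction hk : (inversions w).card generalizing w with
  | zero =>
    refine ⟨[], ?_, rfl⟩
    by_contra hw
    obtain ⟨i, h⟩ := exists_descent (Ne.symm hw)
    have := card_inversions_mul_of_gt h
    omega
  | succ k ih =>
    have hw : w ≠ 1 := by
      rintro rfl
      simp [inversions_one] at hk
    obtain ⟨i, h⟩ := exists_descent hw
    have := card_inversions_mul_of_gt h
    obtain ⟨l, hl, hlen⟩ := ih (w * simpleSwap i) (by omega)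
    refine ⟨l ++ [i], ?_, by simp [hlen]⟩
    simp [hl, mul_assoc, simpleSwap_mul_self]

lemma isReducedExpr_iff {w : Equiv.Perm (Fin n)} {l : List (Fin (n - 1))} :
    IsReducedExpr w l ↔ (l.map simpleSwap).prod = w ∧ l.length = (inversions w).card := by
  constructor
  · rintro ⟨rfl, h⟩
    obtain ⟨l', hl', hlen⟩ := exists_word_length_eq (l.map simpleSwap).prod
    exact ⟨rfl, le_antisymm ((h l' hl').trans hlen.le) (card_inversions_prod_le l)⟩
  · rintro ⟨rfl, h⟩
    refine ⟨rfl, fun l' hl' ↦ ?_⟩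
    rw [h, ← hl']
    exact card_inversions_prod_le l'

lemma isReducedExpr_nil : IsReducedExpr (1 : Equiv.Perm (Fin n)) [] :=
  isReducedExpr_iff.2 ⟨rfl, by simp [inversions_one]⟩

lemma IsReducedExpr.concat {w : Equiv.Perm (Fin n)} {l : List (Fin (n - 1))} {i : Fin (n - 1)}
    (hl : IsReducedExpr w l) (h : w (lo i) < w (hi i)) :
    IsReducedExpr (w * simpleSwap i) (l ++ [i]) := by
  rw [isReducedExpr_iff] at hl ⊢
  simp [hl.1, hl.2, card_inversions_mul_of_lt h]

/-- Splitting off the last letter of a reduced word, which is a descent. -/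
lemma IsReducedExpr.of_concat {w : Equiv.Perm (Fin n)} {l : List (Fin (n - 1))} {i : Fin (n - 1)}
    (hl : IsReducedExpr w (l ++ [i])) :
    w (hi i) < w (lo i) ∧ IsReducedExpr (w * simpleSwap i) l := by
  rw [isReducedExpr_iff] at hl ⊢
  obtain ⟨h1, h2⟩ := hl
  have h3 : (l.map simpleSwap).prod = w * simpleSwap i := by
    rw [← h1]
    simp [mul_assoc, simpleSwap_mul_self]
  have h4 := card_inversions_prod_le l
  rw [h3] at h4
  rw [List.length_append, List.length_singleton] at h2
  rcases apply_lo_lt_or_gt w i with h | h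
  · have := card_inversions_mul_of_lt h
    omega
  · have := card_inversions_mul_of_gt h
    exact ⟨h, h3, by omega⟩

section Matsumoto

variable {M : Type*} [Monoid M] {f : Fin (n - 1) → M}

/-- The case of Matsumoto's theorem where the two reduced words of `w` end in the letters
`i` and `i + 1`: both words can be traded for words ending in `s_i s_{i+1} s_i`. -/
lemma prod_eq_prod_of_hi_eq_lo
    (hbraid : ∀ i j, Adjacent i j → f i * f j * f i = f j * f i * f j)
    {w : Equiv.Perm (Fin n)} {l l' : List (Fin (n - 1))} {i j : Fin (n - 1)} (hij : hi i = lo j)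
    (hl : IsReducedExpr w (l ++ [i])) (hl' : IsReducedExpr w (l' ++ [j]))
    (ih : ∀ k, IsReducedExpr (w * simpleSwap i) k → (l.map f).prod = (k.map f).prod)
    (ih' : ∀ k, IsReducedExpr (w * simpleSwap j) k → (l'.map f).prod = (k.map f).prod) :
    ((l ++ [i]).map f).prod = ((l' ++ [j]).map f).prod := by
  have hd := hl.of_concat.1
  have hd' := hl'.of_concat.1
  have hadj : Adjacent i j := by
    simp only [lo, hi, Fin.ext_iff] at hij
    unfold Adjacent
    rw [← hij]
    simp
  have e1 := simpleSwap_lo_of_hi_eq_lo hij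
  have e2 := simpleSwap_hi_of_hi_eq_lo hij
  have e3 := simpleSwap_lo_eq_lo_of_hi_eq_lo hij
  have hbr := simpleSwap_braid_of_hi_eq_lo hij
  have hc : ∀ k (v : Equiv.Perm (Fin n)), v * simpleSwap k * simpleSwap k = v := fun k v ↦ by
    rw [mul_assoc, simpleSwap_mul_self, mul_one]
  obtain ⟨m, hm⟩ := exists_isReducedExpr (w * simpleSwap i * simpleSwap j * simpleSwap i)
  have hm' : IsReducedExpr (w * simpleSwap j * simpleSwap i * simpleSwap j) m := by
    convert hm using 1
    simp only [mul_assoc] at hbr ⊢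
    rw [hbr]
  rw [hij] at hd
  have c1 := (hm.concat (i := i) (by
    simpa [e1, e2, e3, simpleSwap_lo, simpleSwap_hi, hij] using hd')).concat (i := j) (by
    simpa [e1, e2, e3, simpleSwap_lo, simpleSwap_hi, hij] using hd'.trans hd)
  have c2 := (hm'.concat (i := j) (by
    simpa [e1, e2, e3, simpleSwap_lo, simpleSwap_hi, hij] using hd)).concat (i := i) (by
    simpa [e1, e2, e3, simpleSwap_lo, simpleSwap_hi, hij] using hd'.trans hd)
  rw [hc, hc] at c1 c2
  have p1 := ih _ c1
  have p2 := ih' _ c2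
  have p3 := hbraid i j hadj
  simp only [List.map_append, List.prod_append, List.map_singleton, List.prod_singleton]
    at p1 p2 ⊢
  rw [p1, p2]
  simp only [mul_assoc] at p3 ⊢
  rw [p3]

/-- The case of Matsumoto's theorem where the two reduced words of `w` end in letters that are
not adjacent: both words can be traded for words ending in `s_i s_j`. -/
lemma prod_eq_prod_of_far (hcomm : ∀ i j, Far i j → f i * f j = f j * f i)
    {w : Equiv.Perm (Fin n)} {l l' : List (Fin (n - 1))} {i j : Fin (n - 1)} (hij : Far i j)
    (hl : IsReducedExpr w (l ++ [i])) (hl' : IsReducedExpr w (l' ++ [j]))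
    (ih : ∀ k, IsReducedExpr (w * simpleSwap i) k → (l.map f).prod = (k.map f).prod)
    (ih' : ∀ k, IsReducedExpr (w * simpleSwap j) k → (l'.map f).prod = (k.map f).prod) :
    ((l ++ [i]).map f).prod = ((l' ++ [j]).map f).prod := by
  have hd := hl.of_concat.1
  have hd' := hl'.of_concat.1
  have hbr := simpleSwap_comm hij
  have hc : ∀ k (v : Equiv.Perm (Fin n)), v * simpleSwap k * simpleSwap k = v := fun k v ↦ by
    rw [mul_assoc, simpleSwap_mul_self, mul_one]
  obtain ⟨m, hm⟩ := exists_isReducedExpr (w * simpleSwap i * simpleSwap j)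
  have hm' : IsReducedExpr (w * simpleSwap j * simpleSwap i) m := by
    convert hm using 1
    rw [mul_assoc, mul_assoc, hbr]
  have c1 := hm.concat (i := j) (by
    simpa [simpleSwap_lo, simpleSwap_hi, simpleSwap_lo_of_far hij,
      simpleSwap_hi_of_far hij] using hd')
  have c2 := hm'.concat (i := i) (by
    simpa [simpleSwap_lo, simpleSwap_hi, simpleSwap_lo_of_far hij.symm,
      simpleSwap_hi_of_far hij.symm] using hd)
  rw [hc] at c1 c2
  have p1 := ih _ c1
  have p2 := ih' _ c2
  simp only [List.map_append, List.prod_append, List.map_singleton, List.prod_singleton]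
    at p1 p2 ⊢
  rw [p1, p2, mul_assoc, mul_assoc, hcomm i j hij]

/-- **Matsumoto's theorem** for the symmetric group: if the elements `f i` of a monoid satisfy
the braid relations, then their product along a reduced word of `w` depends only on `w`. -/
theorem prod_map_eq_of_isReducedExpr
    (hbraid : ∀ i j, Adjacent i j → f i * f j * f i = f j * f i * f j)
    (hcomm : ∀ i j, Far i j → f i * f j = f j * f i)
    {w : Equiv.Perm (Fin n)} {l l' : List (Fin (n - 1))}
    (hl : IsReducedExpr w l) (hl' : IsReducedExpr w l') :
    (l.map f).prod = (l'.map f).prod := by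
  induction hk : l.length generalizing w l l' with
  | zero =>
    have h' : l'.length = 0 := by
      rw [(isReducedExpr_iff.1 hl').2, ← (isReducedExpr_iff.1 hl).2, hk]
    rw [List.length_eq_zero_iff.1 hk, List.length_eq_zero_iff.1 h']
  | succ k ih =>
    have h' : l'.length = k + 1 := by
      rw [(isReducedExpr_iff.1 hl').2, ← (isReducedExpr_iff.1 hl).2, hk]
    obtain rfl | ⟨l, i, rfl⟩ := l.eq_nil_or_concat'
    · simp at hk
    obtain rfl | ⟨l', j, rfl⟩ := l'.eq_nil_or_concat'
    · simp at h'
    simp only [List.length_append, List.length_singleton, Nat.add_right_cancel_iff] at hk h'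
    have r := hl.of_concat.2
    have r' := hl'.of_concat.2
    have ih1 : ∀ m, IsReducedExpr (w * simpleSwap i) m → (l.map f).prod = (m.map f).prod :=
      fun m hm ↦ ih r hm hk
    have ih2 : ∀ m, IsReducedExpr (w * simpleSwap j) m → (l'.map f).prod = (m.map f).prod :=
      fun m hm ↦ ih r' hm h'
    obtain rfl | hij | hij := eq_or_adjacent_or_far i j
    · rw [List.map_append, List.prod_append, ih1 _ r', List.map_append, List.prod_append]
    · obtain h | h := hij.hi_eq_lo_or
      · exact prod_eq_prod_of_hi_eq_lo hbraid h hl hl' ih1 ih2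
      · exact (prod_eq_prod_of_hi_eq_lo hbraid h hl' hl ih2 ih1).symm
    · exact prod_eq_prod_of_far hcomm hij hl hl' ih1 ih2

end Matsumoto

/-! ### Linear set partitions and compositions -/

/-- The indices `i` with `i ∼_I i + 1`. They determine a linear set partition. -/
def joined (I : SetPartition n) : Finset (Fin (n - 1)) :=
  Finset.univ.filter fun i ↦ hi i ∈ I.part (lo i)

lemma mem_joined {I : SetPartition n} {i : Fin (n - 1)} :
    i ∈ joined I ↔ hi i ∈ I.part (lo i) := by
  simp [joined]

/-- The number of blocks lying to the left of the block of `a`, for the linear set partition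
whose pairs of neighbours in a common block are those listed in `J`. -/
def colour (J : Finset (Fin (n - 1))) (a : Fin n) : ℕ :=
  (Finset.univ.filter fun i : Fin (n - 1) ↦ i ∉ J ∧ (i : ℕ) < a).card

lemma colour_mono (J : Finset (Fin (n - 1))) : Monotone (colour J) := fun a b h ↦ by
  refine Finset.card_le_card fun i h' ↦ ?_
  simp only [Finset.mem_filter, Finset.mem_univ, true_and] at h' ⊢
  exact ⟨h'.1, h'.2.trans_le h⟩

lemma colour_lt (J : Finset (Fin (n - 1))) (a : Fin n) : colour J a < n := by
  have h : colour J a ≤ n - 1 := (Finset.card_le_univ _).trans_eq (Fintype.card_fin _)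
  have := a.pos
  omega

lemma colour_eq_iff_of_le {J : Finset (Fin (n - 1))} {a b : Fin n} (hab : a ≤ b) :
    colour J a = colour J b ↔ ∀ i, a ≤ lo i → hi i ≤ b → i ∈ J := by
  have hsub : (Finset.univ.filter fun i : Fin (n - 1) ↦ i ∉ J ∧ (i : ℕ) < a) ⊆
      (Finset.univ.filter fun i : Fin (n - 1) ↦ i ∉ J ∧ (i : ℕ) < b) := fun i h ↦ by
    simp only [Finset.mem_filter, Finset.mem_univ, true_and] at h ⊢
    exact ⟨h.1, h.2.trans_le hab⟩
  constructor
  · intro h i h1 h2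
    by_contra hJ
    have heq := Finset.eq_of_subset_of_card_le hsub h.ge
    have hmem : i ∈ (Finset.univ.filter fun i : Fin (n - 1) ↦ i ∉ J ∧ (i : ℕ) < b) :=
      Finset.mem_filter.2 ⟨Finset.mem_univ _, hJ, h2⟩
    rw [← heq] at hmem
    simp only [Finset.mem_filter, Finset.mem_univ, true_and] at hmem
    exact absurd hmem.2 (not_lt.2 h1)
  · intro h
    unfold colour
    congr 1
    refine hsub.antisymm fun i h' ↦ ?_
    simp only [Finset.mem_filter, Finset.mem_univ, true_and] at h' ⊢
    refine ⟨h'.1, lt_of_not_ge fun h1 ↦ h'.1 (h i h1 h'.2)⟩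

lemma colour_lo_eq_colour_hi {J : Finset (Fin (n - 1))} {i : Fin (n - 1)} :
    colour J (lo i) = colour J (hi i) ↔ i ∈ J := by
  rw [colour_eq_iff_of_le (lo_lt_hi i).le]
  refine ⟨fun h ↦ h i le_rfl le_rfl, fun h k h1 h2 ↦ ?_⟩
  have : k = i := by
    simp only [lo, hi, Fin.le_def] at h1 h2
    ext
    omega
  rwa [this]

lemma mem_part_comm {I : SetPartition n} {a b : Fin n} : b ∈ I.part a ↔ a ∈ I.part b := by
  rw [I.mem_part_iff_part_eq_part (Finset.mem_univ _) (Finset.mem_univ _),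
    I.mem_part_iff_part_eq_part (Finset.mem_univ _) (Finset.mem_univ _), eq_comm]

lemma part_eq_part_iff {I : SetPartition n} {a b : Fin n} : I.part a = I.part b ↔ a ∈ I.part b :=
  (I.mem_part_iff_part_eq_part (Finset.mem_univ _) (Finset.mem_univ _)).symm

lemma mem_part_iff_of_le (I : LinearSetPartition n) {a b : Fin n} (hab : a ≤ b) :
    b ∈ I.1.part a ↔ ∀ i, a ≤ lo i → hi i ≤ b → i ∈ joined I.1 := by
  constructor
  · intro h i h1 h2
    have hoc := I.2 _ (I.1.part_mem.2 (Finset.mem_univ a))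
    have ha : a ∈ I.1.part a := I.1.mem_part (Finset.mem_univ a)
    have hlo : lo i ∈ I.1.part a := hoc.out ha h ⟨h1, (lo_lt_hi i).le.trans h2⟩
    have hhi : hi i ∈ I.1.part a := hoc.out ha h ⟨h1.trans (lo_lt_hi i).le, h2⟩
    rw [mem_joined, part_eq_part_iff.2 hlo]
    exact hhi
  · intro h
    obtain ⟨k, hk⟩ := Nat.exists_eq_add_of_le (show (a : ℕ) ≤ b from hab)
    induction k generalizing b with
    | zero =>
      obtain rfl : b = a := Fin.ext hk
      exact I.1.mem_part (Finset.mem_univ b)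
    | succ k ih =>
      have hb := b.2
      let i : Fin (n - 1) := ⟨a + k, by omega⟩
      have hib : hi i = b := Fin.ext (by simp only [hi, i]; omega)
      have hlo : lo i ∈ I.1.part a := ih (b := lo i) (by simp [lo, i, Fin.le_def])
        (fun j h1 h2 ↦ h j h1 (h2.trans ((lo_lt_hi i).le.trans hib.le))) (by simp [lo, i])
      have hmem := mem_joined.1 (h i (by simp [lo, i, Fin.le_def]) hib.le)
      rwa [part_eq_part_iff.2 hlo, hib] at hmem

lemma mem_part_iff_colour_eq (I : LinearSetPartition n) {a b : Fin n} :
    b ∈ I.1.part a ↔ colour (joined I.1) a = colour (joined I.1) b := by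
  rcases le_total a b with h | h
  · rw [mem_part_iff_of_le I h, colour_eq_iff_of_le h]
  · rw [mem_part_comm, mem_part_iff_of_le I h, eq_comm, colour_eq_iff_of_le h]

/-- The linear set partition whose blocks are the fibres of `colour J`. -/
def ofJoined (J : Finset (Fin (n - 1))) : LinearSetPartition n := by
  classical
  refine ⟨Finpartition.ofSetoid (Setoid.ker (colour J)), fun B hB ↦ ⟨fun a ha b hb c hc ↦ ?_⟩⟩
  have hpa := Finpartition.part_eq_of_mem _ hB ha
  rw [← hpa] at hb ⊢
  rw [Finset.mem_coe, Finpartition.mem_part_ofSetoid_iff_rel] at hb ⊢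
  exact le_antisymm (colour_mono J hc.1) ((colour_mono J hc.2).trans hb.ge)

lemma joined_ofJoined (J : Finset (Fin (n - 1))) : joined (ofJoined J).1 = J := by
  classical
  ext i
  rw [mem_joined]
  simp only [ofJoined]
  rw [Finpartition.mem_part_ofSetoid_iff_rel]
  exact colour_lo_eq_colour_hi

lemma setPartition_ext {I I' : SetPartition n}
    (h : ∀ a b, b ∈ I.part a ↔ b ∈ I'.part a) : I = I' := by
  have hp : ∀ a, I.part a = I'.part a := fun a ↦ Finset.ext (h a)
  have key : ∀ K : SetPartition n, ∀ B, B ∈ K.parts ↔ ∃ a, K.part a = B := fun K B ↦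
    ⟨fun hB ↦ by
      obtain ⟨a, ha⟩ := K.nonempty_of_mem_parts hB
      exact ⟨a, K.part_eq_of_mem hB ha⟩, by
      rintro ⟨a, rfl⟩
      exact K.part_mem.2 (Finset.mem_univ a)⟩
  ext B
  simp [key, hp]

lemma joined_injective : Function.Injective fun I : LinearSetPartition n ↦ joined I.1 := by
  intro I I' h
  refine Subtype.ext (setPartition_ext fun a b ↦ ?_)
  rw [mem_part_iff_colour_eq, mem_part_iff_colour_eq, show joined I.1 = joined I'.1 from h]

/-- Linear set partitions correspond to arbitrary sets of pairs of neighbours. -/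
def joinedEquiv : LinearSetPartition n ≃ Finset (Fin (n - 1)) where
  toFun I := joined I.1
  invFun := ofJoined
  left_inv _ := joined_injective (joined_ofJoined _)
  right_inv := joined_ofJoined

instance : Fintype (LinearSetPartition n) := Fintype.ofEquiv _ joinedEquiv.symm

lemma mem_blockMins {I : SetPartition n} {m : Fin n} :
    m ∈ blockMins I ↔ ∀ j ∈ I.part m, m ≤ j := by
  simp [blockMins]

lemma pairwise_blockMins (I : SetPartition n) : (blockMins I).Pairwise (· < ·) :=
  (List.pairwise_lt_finRange n).filter _

lemma exists_blockMin (I : SetPartition n) (a : Fin n) : ∃ m ∈ blockMins I, a ∈ I.part m := by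
  have hne : (I.part a).Nonempty := ⟨a, I.mem_part (Finset.mem_univ a)⟩
  have hm := (I.part a).min'_mem hne
  refine ⟨(I.part a).min' hne, mem_blockMins.2 fun j hj ↦ ?_, mem_part_comm.1 hm⟩
  rw [part_eq_part_iff.2 hm] at hj
  exact Finset.min'_le _ _ hj

lemma blockMin_unique {I : SetPartition n} {m m' a : Fin n} (hm : m ∈ blockMins I)
    (hm' : m' ∈ blockMins I) (ha : a ∈ I.part m) (ha' : a ∈ I.part m') : m = m' := by
  have h : I.part m = I.part m' := by
    rw [← part_eq_part_iff.2 ha, ← part_eq_part_iff.2 ha']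
  rw [mem_blockMins] at hm hm'
  exact le_antisymm (hm m' (part_eq_part_iff.1 h.symm)) (hm' m (part_eq_part_iff.1 h))

lemma mem_take_blockMins {I : SetPartition n} {t : ℕ} (ht : t < (blockMins I).length)
    {m : Fin n} : m ∈ (blockMins I).take t ↔ m ∈ blockMins I ∧ m < (blockMins I)[t] := by
  have hs := List.pairwise_iff_getElem.1 (pairwise_blockMins I)
  rw [List.mem_take_iff_getElem]
  constructor
  · rintro ⟨s, hs', rfl⟩
    exact ⟨List.getElem_mem _, hs _ _ _ _ (by omega)⟩
  · rintro ⟨h1, h2⟩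
    obtain ⟨s, hs', rfl⟩ := List.mem_iff_getElem.1 h1
    refine ⟨s, ?_, rfl⟩
    by_contra h
    have hts : t ≤ s := by omega
    rcases hts.eq_or_lt with rfl | hlt
    · exact lt_irrefl _ h2
    · exact lt_asymm h2 (hs _ _ _ _ hlt)

/-- In a linear set partition the blocks to the left of the block of a minimum `m` fill
exactly the points below `m`. -/
lemma sizeUpTo_blockSizes (I : LinearSetPartition n) {t : ℕ} (ht : t < (blockMins I.1).length) :
    (blockSizes I.1).sizeUpTo t = ((blockMins I.1)[t] : ℕ) := by
  have hm : (blockMins I.1)[t] ∈ blockMins I.1 := List.getElem_mem _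
  have hnd : ((blockMins I.1).take t).Nodup :=
    ((pairwise_blockMins I.1).imp ne_of_lt).sublist (List.take_sublist _ _)
  choose f hf1 hf2 using exists_blockMin I.1
  have hfle : ∀ a, f a ≤ a := fun a ↦ mem_blockMins.1 (hf1 a) a (hf2 a)
  have hmaps : Set.MapsTo f (Finset.Iio (blockMins I.1)[t] : Finset (Fin n))
      (((blockMins I.1).take t).toFinset : Finset (Fin n)) := fun a ha ↦ by
    rw [Finset.mem_coe, Finset.mem_Iio] at ha
    rw [Finset.mem_coe, List.mem_toFinset, mem_take_blockMins ht]
    exact ⟨hf1 a, (hfle a).trans_lt ha⟩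
  have hcard := Finset.card_eq_sum_card_fiberwise hmaps
  rw [Fin.card_Iio] at hcard
  rw [hcard, Composition.sizeUpTo]
  simp only [blockSizes]
  rw [← List.map_take, ← List.sum_toFinset _ hnd]
  refine Finset.sum_congr rfl fun m' hm' ↦ ?_
  rw [List.mem_toFinset, mem_take_blockMins ht] at hm'
  congr 1
  ext a
  rw [Finset.mem_filter, Finset.mem_Iio]
  constructor
  · intro ha
    refine ⟨lt_of_not_ge fun hle ↦ ?_, blockMin_unique (hf1 a) hm'.1 (hf2 a) ha⟩
    -- otherwise the larger minimum lies between `m'` and `a`, hence in the block of `m'`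
    have hmem : (blockMins I.1)[t] ∈ I.1.part m' :=
      (I.2 _ (I.1.part_mem.2 (Finset.mem_univ m'))).out
        (I.1.mem_part (Finset.mem_univ m')) ha ⟨hm'.2.le, hle⟩
    exact hm'.2.ne (blockMin_unique hm'.1 hm hmem (I.1.mem_part (Finset.mem_univ _)))
  · rintro ⟨-, rfl⟩
    exact hf2 a

lemma index_blockSizes (I : LinearSetPartition n) {t : ℕ} (ht : t < (blockMins I.1).length)
    {a : Fin n} (ha : a ∈ I.1.part (blockMins I.1)[t]) :
    ((blockSizes I.1).index a : ℕ) = t := by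
  have hlen : t < (blockSizes I.1).length := by
    simpa [blockSizes, Composition.length] using ht
  have hmin : (blockMins I.1)[t] ≤ a := mem_blockMins.1 (List.getElem_mem _) a ha
  have hcard : Finset.Icc (blockMins I.1)[t] a ⊆ I.1.part (blockMins I.1)[t] := fun x hx ↦
    (I.2 _ (I.1.part_mem.2 (Finset.mem_univ _))).out
        (I.1.mem_part (Finset.mem_univ _)) ha (Finset.mem_Icc.1 hx)
  have h1 := Finset.card_le_card hcard
  rw [Fin.card_Icc] at h1
  have h2 : a ∈ Set.range ((blockSizes I.1).embedding ⟨t, hlen⟩) := by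
    rw [Composition.mem_range_embedding_iff]
    refine ⟨?_, ?_⟩
    · rw [sizeUpTo_blockSizes I ht]
      exact hmin
    · rw [Nat.succ_eq_add_one, Composition.sizeUpTo_succ _ hlen, sizeUpTo_blockSizes I ht]
      simp only [blockSizes, List.getElem_map]
      omega
  rw [Composition.mem_range_embedding_iff'] at h2
  rw [← h2]

lemma index_blockSizes_eq_iff (I : LinearSetPartition n) {a b : Fin n} :
    (blockSizes I.1).index a = (blockSizes I.1).index b ↔
      colour (joined I.1) a = colour (joined I.1) b := by
  rw [← mem_part_iff_colour_eq]
  obtain ⟨m, hm, ha⟩ := exists_blockMin I.1 a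
  obtain ⟨m', hm', hb⟩ := exists_blockMin I.1 b
  obtain ⟨t, ht, rfl⟩ := List.mem_iff_getElem.1 hm
  obtain ⟨s, hs, rfl⟩ := List.mem_iff_getElem.1 hm'
  rw [Fin.ext_iff, index_blockSizes I ht ha, index_blockSizes I hs hb]
  constructor
  · rintro rfl
    rwa [part_eq_part_iff.2 ha]
  · intro h
    rw [part_eq_part_iff.2 ha] at h
    have hnd : (blockMins I.1).Nodup := (pairwise_blockMins I.1).imp ne_of_lt
    exact hnd.getElem_inj_iff.1 (blockMin_unique hm hm' h hb)

lemma mem_youngSubgroup_blockSizes (I : LinearSetPartition n) {w : Equiv.Perm (Fin n)} :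
    w ∈ youngSubgroup (blockSizes I.1) ↔
      ∀ a, colour (joined I.1) (w a) = colour (joined I.1) a :=
  forall_congr' fun _ ↦ index_blockSizes_eq_iff I

lemma blockSizes_injective :
    Function.Injective fun I : LinearSetPartition n ↦ blockSizes I.1 := by
  intro I I' h
  refine joined_injective (Finset.ext fun i ↦ ?_)
  rw [← colour_lo_eq_colour_hi, ← colour_lo_eq_colour_hi, ← index_blockSizes_eq_iff,
    ← index_blockSizes_eq_iff, show blockSizes I.1 = blockSizes I'.1 from h]

lemma blockSizes_bijective :
    Function.Bijective fun I : LinearSetPartition n ↦ blockSizes I.1 := by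
  rw [Fintype.bijective_iff_injective_and_card]
  refine ⟨blockSizes_injective, ?_⟩
  rw [Fintype.card_congr joinedEquiv, composition_card]
  simp

lemma card_youngSubgroup (μ : Composition n) :
    Nat.card (youngSubgroup μ) = (μ.blocks.map Nat.factorial).prod := by
  classical
  have hfib : ∀ i, Fintype.card {a : Fin n // μ.index a = i} = μ.blocksFun i := fun i ↦ by
    rw [← Fintype.card_fin (μ.blocksFun i)]
    refine Fintype.card_congr (Equiv.ofBijective
      (fun x ↦ (⟨μ.embedding i x, μ.index_embedding i x⟩ : {a : Fin n // μ.index a = i}))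
      ⟨fun x y h ↦ (μ.embedding i).injective (congrArg Subtype.val h), ?_⟩).symm
    rintro ⟨a, rfl⟩
    exact ⟨μ.invEmbedding a, Subtype.ext (μ.embedding_comp_inv a)⟩
  have hcongr : Nat.card (youngSubgroup μ) =
      Fintype.card {g : Equiv.Perm (Fin n) // μ.index ∘ g = μ.index} := by
    rw [← Nat.card_eq_fintype_card]
    exact Nat.card_congr (Equiv.subtypeEquivRight fun w ↦ by
      rw [funext_iff]; rfl)
  rw [hcongr, DomMulAct.stabilizer_card, ← μ.ofFn_blocksFun, List.map_ofFn, List.prod_ofFn]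
  exact Finset.prod_congr rfl fun i _ ↦ by rw [hfib]; rfl

lemma card_sigma_youngSubgroup :
    Nat.card (Σ I : LinearSetPartition n, youngSubgroup (blockSizes I.1)) =
      ∑ μ : Composition n, (μ.blocks.map Nat.factorial).prod := by
  rw [Nat.card_sigma]
  simp only [card_youngSubgroup]
  exact blockSizes_bijective.sum_comp fun μ : Composition n ↦ (μ.blocks.map Nat.factorial).prod

/-- A permutation in a Young subgroup has its descents inside the blocks. -/
lemma mem_of_descent {J : Finset (Fin (n - 1))} {w : Equiv.Perm (Fin n)}
    (hw : ∀ a, colour J (w a) = colour J a) {i : Fin (n - 1)} (h : w (hi i) < w (lo i)) :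
    i ∈ J := by
  rw [← colour_lo_eq_colour_hi]
  refine le_antisymm (colour_mono J (lo_lt_hi i).le) ?_
  rw [← hw (hi i), ← hw (lo i)]
  exact colour_mono J h.le

lemma colour_simpleSwap {J : Finset (Fin (n - 1))} {i : Fin (n - 1)} (h : i ∈ J) (a : Fin n) :
    colour J (simpleSwap i a) = colour J a := by
  have := colour_lo_eq_colour_hi.2 h
  rcases eq_or_ne a (lo i) with rfl | h1
  · rw [simpleSwap_lo, this]
  rcases eq_or_ne a (hi i) with rfl | h2
  · rw [simpleSwap_hi, this]
  rw [simpleSwap, Equiv.swap_apply_of_ne_of_ne h1 h2]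

lemma colour_eq_of_subset {J K : Finset (Fin (n - 1))} (h : J ⊆ K) {a b : Fin n}
    (hab : colour J a = colour J b) : colour K a = colour K b := by
  rcases le_total a b with h' | h'
  · rw [colour_eq_iff_of_le h'] at hab ⊢
    exact fun i h1 h2 ↦ h (hab i h1 h2)
  · rw [eq_comm, colour_eq_iff_of_le h'] at hab ⊢
    exact fun i h1 h2 ↦ h (hab i h1 h2)

/-! ### The operators on the tensor space -/

/-- The coefficient of `v_x ⊗ v_y` in `(v_x ⊗ v_y) 𝐆`. -/
def coeffStay (x y : Fin n × Fin r) : GroundRing :=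
  if x.2 = y.2 then if x.1 = y.1 then q else if x.1 < y.1 then q - qInv else 0 else 0

/-- The coefficient of `v_y ⊗ v_x` in `(v_x ⊗ v_y) 𝐆`, taken to be `0` if `x = y`. -/
def coeffSwap (x y : Fin n × Fin r) : GroundRing := if x = y then 0 else 1

lemma q_mul_q : q * q = 1 + (q - qInv) * q := by
  have : qInv * q = 1 := by
    rw [q, qInv, ← LaurentPolynomial.T_add]
    simp
  linear_combination this

lemma opE_vPair (x y : Fin n × Fin r) :
    opE n r (vPair x y) = if x.2 = y.2 then vPair x y else 0 := by
  have h := ((vBasis n r).tensorProduct (vBasis n r)).constr_basis GroundRing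
    (fun p ↦ if p.1.2 = p.2.2 then vPair p.1 p.2 else 0) (x, y)
  rwa [Module.Basis.tensorProduct_apply] at h

lemma opG_vPair (x y : Fin n × Fin r) :
    opG n r (vPair x y) = coeffStay x y • vPair x y + coeffSwap x y • vPair y x := by
  have h := ((vBasis n r).tensorProduct (vBasis n r)).constr_basis GroundRing
    (fun p ↦ if p.1.2 ≠ p.2.2 then vPair p.2 p.1
    else if p.1.1 = p.2.1 then q • vPair p.1 p.2
    else if p.2.1 < p.1.1 then vPair p.2 p.1
    else (q - qInv) • vPair p.1 p.2 + vPair p.2 p.1) (x, y)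
  rw [Module.Basis.tensorProduct_apply] at h
  refine Eq.trans h ?_
  obtain ⟨i, a⟩ := x
  obtain ⟨j, b⟩ := y
  simp only [coeffStay, coeffSwap, Prod.mk.injEq]
  by_cases hab : a = b
  · rcases lt_trichotomy i j with hij | hij | hij
    · simp [hab, hij, hij.ne, hij.not_gt]
    · simp [hab, hij]
    · simp [hab, hij, hij.ne', hij.not_gt]
  · simp [hab]

lemma insertPair_vPair (i : Fin (n - 1)) (f : Fin n → Fin n × Fin r) (x y : Fin n × Fin r) :
    insertPair i f (vPair x y) =
      tensorBasis n r (Function.update (Function.update f (lo i) x) (hi i) y) := by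
  have h := ((vBasis n r).tensorProduct (vBasis n r)).constr_basis GroundRing
    (fun p ↦ tensorBasis n r (Function.update (Function.update f (lo i) p.1) (hi i) p.2)) (x, y)
  rwa [Module.Basis.tensorProduct_apply] at h

lemma update_update_self (i : Fin (n - 1)) (f : Fin n → Fin n × Fin r) :
    Function.update (Function.update f (lo i) (f (lo i))) (hi i) (f (hi i)) = f := by
  simp

lemma update_update_swap (i : Fin (n - 1)) (f : Fin n → Fin n × Fin r) :
    Function.update (Function.update f (lo i) (f (hi i))) (hi i) (f (lo i)) =
      f ∘ simpleSwap i := by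
  funext a
  rcases eq_or_ne a (hi i) with rfl | h2
  · simp [simpleSwap_hi]
  rcases eq_or_ne a (lo i) with rfl | h1
  · simp [simpleSwap_lo, h2]
  simp [h1, h2, simpleSwap, Equiv.swap_apply_of_ne_of_ne h1 h2]

/-- The coefficient of `v_x ⊗ v_y` in `(v_x ⊗ v_y) 𝐄`. -/
def coeffTie (x y : Fin n × Fin r) : GroundRing := if x.2 = y.2 then 1 else 0

lemma coeffTie_comm (x y : Fin n × Fin r) : coeffTie x y = coeffTie y x := by
  simp only [coeffTie, eq_comm]

/-- The operator `𝐄_i`. -/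
abbrev tensorE (r : ℕ) (i : Fin (n - 1)) : Module.End GroundRing (TensorSpace n r) :=
  actAt i (opE n r)

/-- The operator `𝐆_i`. -/
abbrev tensorG (r : ℕ) (i : Fin (n - 1)) : Module.End GroundRing (TensorSpace n r) :=
  actAt i (opG n r)

lemma tensorE_apply (i : Fin (n - 1)) (f : Fin n → Fin n × Fin r) :
    tensorE r i (tensorBasis n r f) =
      coeffTie (f (lo i)) (f (hi i)) • tensorBasis n r f := by
  rw [tensorE, actAt, Module.Basis.constr_basis, opE_vPair, coeffTie]
  split_ifs
  · rw [insertPair_vPair, update_update_self, one_smul]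
  · rw [map_zero, zero_smul]

lemma tensorG_apply (i : Fin (n - 1)) (f : Fin n → Fin n × Fin r) :
    tensorG r i (tensorBasis n r f) =
      coeffStay (f (lo i)) (f (hi i)) • tensorBasis n r f +
        coeffSwap (f (lo i)) (f (hi i)) • tensorBasis n r (f ∘ simpleSwap i) := by
  rw [tensorG, actAt, Module.Basis.constr_basis, opG_vPair, map_add, map_smul, map_smul,
    insertPair_vPair, insertPair_vPair, update_update_self, update_update_swap]

lemma coeffStay_mul_coeffStay (x y : Fin n × Fin r) :
    coeffStay x y * coeffStay x y + coeffSwap x y * coeffSwap y x =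
      1 + (q - qInv) * coeffStay x y := by
  have hq := q_mul_q
  generalize hα : q - qInv = α at hq
  simp only [coeffStay, coeffSwap, Prod.ext_iff, hα]
  grind

/-- Together with `braid_coeff_left` and `braid_coeff_right`, the comparison of the coefficients of
the two sides of the braid relation for `𝐆` on `v_x ⊗ v_y ⊗ v_z`; the other coefficients agree
trivially. -/
lemma braid_coeff (x y z : Fin n × Fin r) :
    coeffStay x y * coeffStay x y * coeffStay y z + coeffSwap x y * coeffSwap y x * coeffStay x z
      = coeffStay y z * coeffStay y z * coeffStay x y +
        coeffSwap y z * coeffSwap z y * coeffStay x z := by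
  have hq := q_mul_q
  generalize hα : q - qInv = α at hq
  simp only [coeffStay, coeffSwap, Prod.ext_iff, hα]
  grind

lemma braid_coeff_left (x y z : Fin n × Fin r) :
    coeffSwap x y * (coeffStay x y * coeffStay y z + coeffStay x z * coeffStay y x) =
      coeffSwap x y * (coeffStay y z * coeffStay x z) := by
  have hq := q_mul_q
  generalize hα : q - qInv = α at hq
  simp only [coeffStay, coeffSwap, Prod.ext_iff, hα]
  grind

lemma braid_coeff_right (x y z : Fin n × Fin r) :
    coeffSwap y z * (coeffStay x y * coeffStay x z) =
      coeffSwap y z * (coeffStay y z * coeffStay x y + coeffStay x z * coeffStay z y) := by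
  have hq := q_mul_q
  generalize hα : q - qInv = α at hq
  simp only [coeffStay, coeffSwap, Prod.ext_iff, hα]
  grind

lemma tensorEnd_ext {A B : Module.End GroundRing (TensorSpace n r)}
    (h : ∀ f, A (tensorBasis n r f) = B (tensorBasis n r f)) : A = B :=
  (tensorBasis n r).ext h

lemma tensorE_mul_self (i : Fin (n - 1)) : tensorE r i * tensorE r i = tensorE r i := by
  refine tensorEnd_ext fun f ↦ ?_
  simp only [Module.End.mul_apply, tensorE_apply, map_smul, smul_smul]
  congr 1
  simp [coeffTie]

lemma tensorE_comm (i j : Fin (n - 1)) :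
    tensorE r i * tensorE r j = tensorE r j * tensorE r i := by
  refine tensorEnd_ext fun f ↦ ?_
  simp only [Module.End.mul_apply, tensorE_apply, map_smul, smul_smul]
  rw [mul_comm]

lemma tensorE_mul_tensorG (i : Fin (n - 1)) :
    tensorE r i * tensorG r i = tensorG r i * tensorE r i := by
  refine tensorEnd_ext fun f ↦ ?_
  simp only [Module.End.mul_apply, tensorE_apply, tensorG_apply, map_smul, map_add,
    Function.comp_apply, simpleSwap_lo, simpleSwap_hi, coeffTie_comm (f (hi i))]
  module

lemma comp_simpleSwap_simpleSwap (i : Fin (n - 1)) (f : Fin n → Fin n × Fin r) :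
    (f ∘ simpleSwap i) ∘ simpleSwap i = f := by
  funext a
  simp [simpleSwap_simpleSwap]

lemma tensorG_mul_self (i : Fin (n - 1)) :
    tensorG r i * tensorG r i = 1 + (q - qInv) • (tensorE r i * tensorG r i) := by
  refine tensorEnd_ext fun f ↦ ?_
  have h := coeffStay_mul_coeffStay (f (lo i)) (f (hi i))
  have h1 : coeffSwap (f (lo i)) (f (hi i)) *
      (coeffStay (f (lo i)) (f (hi i)) + coeffStay (f (hi i)) (f (lo i))) =
      (q - qInv) * coeffSwap (f (lo i)) (f (hi i)) * coeffTie (f (lo i)) (f (hi i)) := by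
    generalize hα : q - qInv = α
    simp only [coeffStay, coeffSwap, coeffTie, Prod.ext_iff, hα]
    grind
  have h2 : coeffStay (f (lo i)) (f (hi i)) * coeffTie (f (lo i)) (f (hi i)) =
      coeffStay (f (lo i)) (f (hi i)) := by
    simp only [coeffStay, coeffTie]
    grind
  simp only [Module.End.mul_apply, tensorE_apply, tensorG_apply, map_smul, map_add,
    Function.comp_apply, simpleSwap_lo, simpleSwap_hi, coeffTie_comm (f (hi i)),
    LinearMap.add_apply, LinearMap.smul_apply, Module.End.one_apply, comp_simpleSwap_simpleSwap]
  match_scalars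
  · linear_combination h - (q - qInv) * h2
  · linear_combination h1

lemma tensorG_comm {i j : Fin (n - 1)} (h : Far i j) :
    tensorG r i * tensorG r j = tensorG r j * tensorG r i := by
  refine tensorEnd_ext fun f ↦ ?_
  have hs : (f ∘ simpleSwap j) ∘ simpleSwap i = (f ∘ simpleSwap i) ∘ simpleSwap j := by
    rw [Function.comp_assoc, Function.comp_assoc, ← Equiv.Perm.coe_mul, ← Equiv.Perm.coe_mul,
      simpleSwap_comm h]
  simp only [Module.End.mul_apply, tensorG_apply, map_smul, map_add,
    Function.comp_apply, simpleSwap_lo_of_far h, simpleSwap_hi_of_far h,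
    simpleSwap_lo_of_far h.symm, simpleSwap_hi_of_far h.symm, hs]
  module

lemma tensorE_mul_tensorG_of_far {i j : Fin (n - 1)} (h : Far i j) :
    tensorE r i * tensorG r j = tensorG r j * tensorE r i := by
  refine tensorEnd_ext fun f ↦ ?_
  simp only [Module.End.mul_apply, tensorG_apply, tensorE_apply, map_smul, map_add,
    Function.comp_apply, simpleSwap_lo_of_far h.symm, simpleSwap_hi_of_far h.symm]
  module

lemma tensorG_braid {i j : Fin (n - 1)} (h : hi i = lo j) :
    tensorG r i * tensorG r j * tensorG r i = tensorG r j * tensorG r i * tensorG r j := by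
  refine tensorEnd_ext fun f ↦ ?_
  have hs : ((f ∘ simpleSwap i) ∘ simpleSwap j) ∘ simpleSwap i =
      ((f ∘ simpleSwap j) ∘ simpleSwap i) ∘ simpleSwap j := by
    simp only [Function.comp_assoc, ← Equiv.Perm.coe_mul]
    rw [simpleSwap_braid_of_hi_eq_lo h]
  have h1 := braid_coeff (f (lo i)) (f (lo j)) (f (hi j))
  have h2 := braid_coeff_left (f (lo i)) (f (lo j)) (f (hi j))
  have h3 := braid_coeff_right (f (lo i)) (f (lo j)) (f (hi j))
  simp only [Module.End.mul_apply, tensorG_apply, map_smul, map_add, h,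
    Function.comp_apply, simpleSwap_lo, simpleSwap_hi, comp_simpleSwap_simpleSwap, hs,
    simpleSwap_lo_of_hi_eq_lo h, simpleSwap_hi_of_hi_eq_lo h, simpleSwap_lo_eq_lo_of_hi_eq_lo h]
  match_scalars
  · linear_combination h1
  · linear_combination h2
  · linear_combination h3
  · ring
  · ring
  · ring

lemma tensorG_mul_tensorG_mul_tensorE {i j : Fin (n - 1)} (h : Adjacent i j) :
    tensorG r i * tensorG r j * tensorE r i = tensorE r j * tensorG r i * tensorG r j := by
  refine tensorEnd_ext fun f ↦ ?_
  rcases h.hi_eq_lo_or with h | h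
  all_goals
    simp only [Module.End.mul_apply, tensorG_apply, tensorE_apply, map_smul, map_add, h,
      Function.comp_apply, simpleSwap_lo, simpleSwap_hi,
      simpleSwap_lo_of_hi_eq_lo h, simpleSwap_hi_of_hi_eq_lo h, simpleSwap_lo_eq_lo_of_hi_eq_lo h]
    generalize hα : q - qInv = α
    match_scalars <;> simp only [coeffStay, coeffTie, hα] <;> grind

/-- On a tensor tied at two neighbouring pairs the three colours agree, so that `𝐆_j` does not
change the pattern of ties. -/
lemma tensorG_mul_tensorE_mul_tensorE {i j : Fin (n - 1)} (h : Adjacent i j) :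
    tensorG r j * tensorE r j * tensorE r i = tensorE r i * tensorG r j * tensorE r i := by
  refine tensorEnd_ext fun f ↦ ?_
  rcases h.hi_eq_lo_or with h | h
  all_goals
    simp only [Module.End.mul_apply, tensorG_apply, tensorE_apply, map_smul, map_add, h,
      Function.comp_apply, simpleSwap_lo,
      simpleSwap_lo_of_hi_eq_lo h, simpleSwap_hi_of_hi_eq_lo h, simpleSwap_lo_eq_lo_of_hi_eq_lo h]
    generalize hα : q - qInv = α
    match_scalars <;> simp only [coeffStay, coeffTie, hα] <;> grind

lemma tensorE_mul_tensorG_mul_tensorE {i j : Fin (n - 1)} (h : Adjacent i j) :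
    tensorE r i * tensorG r j * tensorE r i = tensorE r j * tensorE r i * tensorG r j := by
  refine tensorEnd_ext fun f ↦ ?_
  rcases h.hi_eq_lo_or with h | h
  all_goals
    simp only [Module.End.mul_apply, tensorG_apply, tensorE_apply, map_smul, map_add, h,
      Function.comp_apply, simpleSwap_lo, simpleSwap_hi,
      simpleSwap_lo_of_hi_eq_lo h, simpleSwap_hi_of_hi_eq_lo h, simpleSwap_lo_eq_lo_of_hi_eq_lo h]
    generalize hα : q - qInv = α
    match_scalars <;> simp only [coeffStay, coeffTie, hα] <;> grind

open MulOpposite in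
/-- The representation of the algebra of braids and ties on the tensor space, by operators
acting on the right. -/
def btRep (n r : ℕ) :
    BraidsTies n →ₐ[GroundRing] (Module.End GroundRing (TensorSpace n r))ᵐᵒᵖ :=
  RingQuot.liftAlgHom GroundRing ⟨FreeAlgebra.lift GroundRing fun
    | BTGen.e i => op (tensorE r i)
    | BTGen.g i => op (tensorG r i), by
    intro x y hxy
    induction hxy <;>
      simp only [BTGen.E, BTGen.G, map_mul, map_add, map_one, map_smul, FreeAlgebra.lift_ι_apply,
        ← op_mul, ← op_add, ← op_smul, ← op_one, op_inj, ← mul_assoc]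
    case e_sq i => exact tensorE_mul_self i
    case e_comm i j => exact tensorE_comm j i
    case g_braid i j h =>
      obtain h | h := h.hi_eq_lo_or
      · exact tensorG_braid h
      · exact (tensorG_braid h).symm
    case g_comm i j h => exact tensorG_comm h.symm
    case g_e_comm i => exact tensorE_mul_tensorG i
    case g_e_comm_far i j h => exact tensorE_mul_tensorG_of_far h.symm
    case e_g_g i j h => exact tensorG_mul_tensorG_mul_tensorE h
    case e_e_g i j h => exact tensorG_mul_tensorE_mul_tensorE h
    case e_g_e i j h => exact tensorE_mul_tensorG_mul_tensorE h
    case g_sq i => rw [tensorG_mul_self, tensorE_mul_tensorG]⟩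

lemma btRep_btE (i : Fin (n - 1)) : btRep n r (btE i) = MulOpposite.op (tensorE r i) := by
  simp [btRep, btE, BTGen.E]

lemma btRep_btG (i : Fin (n - 1)) : btRep n r (btG i) = MulOpposite.op (tensorG r i) := by
  simp [btRep, btG, BTGen.G]

/-! ### Relations in the two algebras and the homomorphism between them -/

lemma btE_mul_self (i : Fin (n - 1)) : btE i * btE i = btE i := by
  simpa only [map_mul, btE, btG] using RingQuot.mkAlgHom_rel GroundRing (BTRel.e_sq i)

lemma btE_comm (i j : Fin (n - 1)) : btE i * btE j = btE j * btE i := by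
  simpa only [map_mul, btE, btG] using RingQuot.mkAlgHom_rel GroundRing (BTRel.e_comm i j)

lemma btG_braid {i j : Fin (n - 1)} (h : Adjacent i j) :
    btG i * btG j * btG i = btG j * btG i * btG j := by
  simpa only [map_mul, btE, btG] using RingQuot.mkAlgHom_rel GroundRing (BTRel.g_braid i j h)

lemma btG_comm {i j : Fin (n - 1)} (h : Far i j) : btG i * btG j = btG j * btG i := by
  simpa only [map_mul, btE, btG] using RingQuot.mkAlgHom_rel GroundRing (BTRel.g_comm i j h)

lemma btG_mul_btE (i : Fin (n - 1)) : btG i * btE i = btE i * btG i := by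
  simpa only [map_mul, btE, btG] using RingQuot.mkAlgHom_rel GroundRing (BTRel.g_e_comm i)

lemma btG_mul_btE_of_far {i j : Fin (n - 1)} (h : Far i j) : btG i * btE j = btE j * btG i := by
  simpa only [map_mul, btE, btG] using RingQuot.mkAlgHom_rel GroundRing (BTRel.g_e_comm_far i j h)

lemma btE_mul_btE_mul_btG {i j : Fin (n - 1)} (h : Adjacent i j) :
    btE i * btE j * btG j = btE i * btG j * btE i := by
  simpa only [map_mul, btE, btG] using RingQuot.mkAlgHom_rel GroundRing (BTRel.e_e_g i j h)

lemma btE_mul_btG_mul_btE {i j : Fin (n - 1)} (h : Adjacent i j) :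
    btE i * btG j * btE i = btG j * btE i * btE j := by
  simpa only [map_mul, btE, btG] using RingQuot.mkAlgHom_rel GroundRing (BTRel.e_g_e i j h)

lemma btG_mul_self (i : Fin (n - 1)) : btG i * btG i = 1 + (q - qInv) • (btE i * btG i) := by
  simpa only [map_mul, map_add, map_smul, map_one, btE, btG] using
    RingQuot.mkAlgHom_rel GroundRing (BTRel.g_sq i)

/-- The ties `e_i` commute with the elements `e_j g_j`, although not with the `g_j`. -/
lemma btE_comm_btE_mul_btG (i j : Fin (n - 1)) :
    btE i * (btE j * btG j) = btE j * btG j * btE i := by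
  obtain rfl | h | h := eq_or_adjacent_or_far i j
  · rw [mul_assoc, btG_mul_btE]
  · rw [← mul_assoc, btE_mul_btE_mul_btG h, btE_mul_btG_mul_btE h, mul_assoc, btE_comm i j,
      ← mul_assoc, btG_mul_btE]
  · rw [mul_assoc, btG_mul_btE_of_far h.symm, ← mul_assoc, ← mul_assoc, btE_comm]

/-- Both sides equal `e_i e_j` times the corresponding word in the `g`'s. -/
lemma btE_mul_btG_braid {i j : Fin (n - 1)} (h : Adjacent i j) :
    btE i * btG i * (btE j * btG j) * (btE i * btG i) =
      btE j * btG j * (btE i * btG i) * (btE j * btG j) := by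
  have key : ∀ k l : Fin (n - 1), btE k * btG k * (btE l * btG l) * (btE k * btG k) =
      btE l * btE k * (btG k * btG l * btG k) := fun k l ↦ by
    calc btE k * btG k * (btE l * btG l) * (btE k * btG k)
        = btE k * btG k * ((btE l * btG l) * btE k) * btG k := by simp only [mul_assoc]
      _ = btE k * (btG k * btE k) * (btE l * btG l) * btG k := by
          rw [← btE_comm_btE_mul_btG]; simp only [mul_assoc]
      _ = (btE k * btE k) * btG k * (btE l * btG l) * btG k := by
          rw [btG_mul_btE]; simp only [mul_assoc]
      _ = (btE k * btG k * btE l) * btG l * btG k := by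
          rw [btE_mul_self]; simp only [mul_assoc]
      _ = btE l * btE k * (btG k * btG l * btG k) := by
          rw [← btE_comm_btE_mul_btG]; simp only [mul_assoc]
  rw [key, key, btG_braid h, btE_comm]

/-- The homomorphism `ι_1`, given by `e_i ↦ e_i` and `z_i ↦ e_i g_i`. -/
def bhToBT (n : ℕ) : BoxedHecke n →ₐ[GroundRing] BraidsTies n :=
  RingQuot.liftAlgHom GroundRing ⟨FreeAlgebra.lift GroundRing fun
    | BHGen.e i => btE i
    | BHGen.z i => btE i * btG i, by
    intro x y hxy
    induction hxy <;>
      simp only [BHGen.E, BHGen.Z, map_mul, map_add, map_smul, FreeAlgebra.lift_ι_apply]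
    case e_sq i => exact btE_mul_self i
    case e_comm i j => exact btE_comm i j
    case z_braid i j h => exact btE_mul_btG_braid h
    case z_comm i j h =>
      calc btE i * btG i * (btE j * btG j) = btE i * (btG i * btE j) * btG j := by
            simp only [mul_assoc]
        _ = btE i * btE j * (btG i * btG j) := by
            rw [btG_mul_btE_of_far h]; simp only [mul_assoc]
        _ = btE j * (btE i * btG j) * btG i := by
            rw [btE_comm, btG_comm h]; simp only [mul_assoc]
        _ = btE j * btG j * (btE i * btG i) := by
            rw [← btG_mul_btE_of_far h.symm]; simp only [mul_assoc]
    case e_mul_z i => rw [← mul_assoc, btE_mul_self]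
    case e_z_comm i j => exact btE_comm_btE_mul_btG i j
    case z_sq i =>
      rw [mul_assoc, ← mul_assoc (btG i), btG_mul_btE, mul_assoc, ← mul_assoc, btE_mul_self,
        btG_mul_self, mul_add, mul_one, mul_smul_comm, ← mul_assoc, btE_mul_self]⟩

lemma bhToBT_bhE (i : Fin (n - 1)) : bhToBT n (bhE i) = btE i := by
  simp [bhToBT, bhE, BHGen.E]

lemma bhToBT_bhZ (i : Fin (n - 1)) : bhToBT n (bhZ i) = btE i * btG i := by
  simp [bhToBT, bhZ, BHGen.Z]

lemma bhE_mul_self (i : Fin (n - 1)) : bhE i * bhE i = bhE i := by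
  simpa only [map_mul, bhE, bhZ] using RingQuot.mkAlgHom_rel GroundRing (BHRel.e_sq i)

lemma bhE_comm (i j : Fin (n - 1)) : bhE i * bhE j = bhE j * bhE i := by
  simpa only [map_mul, bhE, bhZ] using RingQuot.mkAlgHom_rel GroundRing (BHRel.e_comm i j)

lemma bhZ_braid (i j : Fin (n - 1)) (h : Adjacent i j) :
    bhZ i * bhZ j * bhZ i = bhZ j * bhZ i * bhZ j := by
  simpa only [map_mul, bhE, bhZ] using RingQuot.mkAlgHom_rel GroundRing (BHRel.z_braid i j h)

lemma bhZ_comm (i j : Fin (n - 1)) (h : Far i j) : bhZ i * bhZ j = bhZ j * bhZ i := by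
  simpa only [map_mul, bhE, bhZ] using RingQuot.mkAlgHom_rel GroundRing (BHRel.z_comm i j h)

lemma bhE_mul_bhZ (i : Fin (n - 1)) : bhE i * bhZ i = bhZ i := by
  simpa only [map_mul, bhE, bhZ] using RingQuot.mkAlgHom_rel GroundRing (BHRel.e_mul_z i)

lemma bhE_comm_bhZ (i j : Fin (n - 1)) : bhE i * bhZ j = bhZ j * bhE i := by
  simpa only [map_mul, bhE, bhZ] using RingQuot.mkAlgHom_rel GroundRing (BHRel.e_z_comm i j)

lemma bhZ_mul_self (i : Fin (n - 1)) : bhZ i * bhZ i = bhE i + (q - qInv) • bhZ i := by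
  simpa only [map_mul, map_add, map_smul, bhE, bhZ] using
    RingQuot.mkAlgHom_rel GroundRing (BHRel.z_sq i)

/-! ### The elements `E_I z_w` span -/

lemma boxedHecke_induction {P : BoxedHecke n → Prop} (hc : ∀ c, P (algebraMap GroundRing _ c))
    (he : ∀ i, P (bhE i)) (hz : ∀ i, P (bhZ i)) (hmul : ∀ x y, P x → P y → P (x * y))
    (hadd : ∀ x y, P x → P y → P (x + y)) (x : BoxedHecke n) : P x := by
  obtain ⟨y, rfl⟩ := RingQuot.mkAlgHom_surjective GroundRing (BHRel n) x
  induction y using FreeAlgebra.induction with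
  | grade0 c => rw [AlgHom.commutes]; exact hc c
  | grade1 g =>
    cases g with
    | e i => exact he i
    | z i => exact hz i
  | mul a b ha hb => rw [map_mul]; exact hmul _ _ ha hb
  | add a b ha hb => rw [map_add]; exact hadd _ _ ha hb

lemma bhE_mem_center (i : Fin (n - 1)) :
    bhE i ∈ Subalgebra.center GroundRing (BoxedHecke n) := by
  rw [Subalgebra.mem_center_iff]
  intro x
  induction x using boxedHecke_induction with
  | hc c => rw [Algebra.commutes]
  | he j => exact bhE_comm j i
  | hz j => exact (bhE_comm_bhZ i j).symm
  | hmul x y hx hy => rw [mul_assoc, hy, ← mul_assoc, hx, mul_assoc]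
  | hadd x y hx hy => rw [add_mul, mul_add, hx, hy]

/-- The product of the central elements `e_i`, `i ∈ J`. -/
def bhEProd (J : Finset (Fin (n - 1))) : Subalgebra.center GroundRing (BoxedHecke n) :=
  ∏ i ∈ J, ⟨bhE i, bhE_mem_center i⟩

lemma bhEPart_eq (I : SetPartition n) : bhEPart I = bhEProd (joined I) := by
  have hnd : ((List.finRange (n - 1)).filter fun i ↦ hi i ∈ I.part (lo i)).Nodup :=
    (List.nodup_finRange _).filter _
  have hJ : joined I = ((List.finRange (n - 1)).filter fun i ↦ hi i ∈ I.part (lo i)).toFinset := by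
    ext i
    simp [joined]
  rw [bhEPart, bhEProd, hJ, List.prod_toFinset _ hnd, ← Subalgebra.coe_val, map_list_prod,
    List.map_map]
  rfl

lemma bhE_mul_bhEProd (i : Fin (n - 1)) (J : Finset (Fin (n - 1))) :
    bhE i * bhEProd J = (bhEProd (insert i J) : BoxedHecke n) := by
  have hi : (⟨bhE i, bhE_mem_center i⟩ * ⟨bhE i, bhE_mem_center i⟩ :
      Subalgebra.center GroundRing (BoxedHecke n)) = ⟨bhE i, bhE_mem_center i⟩ :=
    Subtype.ext (bhE_mul_self i)
  have h : (⟨bhE i, bhE_mem_center i⟩ : Subalgebra.center GroundRing (BoxedHecke n)) * bhEProd J =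
      bhEProd (insert i J) := by
    by_cases hJ : i ∈ J
    · rw [Finset.insert_eq_of_mem hJ, bhEProd, ← Finset.mul_prod_erase _ _ hJ, ← mul_assoc, hi]
    · rw [bhEProd, bhEProd, Finset.prod_insert hJ]
  exact congrArg Subtype.val h

lemma bhZWord_eq_bhZPerm {w : Equiv.Perm (Fin n)} {l : List (Fin (n - 1))}
    (hl : IsReducedExpr w l) : bhZWord l = bhZPerm w :=
  prod_map_eq_of_isReducedExpr bhZ_braid bhZ_comm hl (exists_isReducedExpr w).choose_spec

lemma bhZPerm_one : bhZPerm (1 : Equiv.Perm (Fin n)) = 1 :=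
  (bhZWord_eq_bhZPerm isReducedExpr_nil).symm

lemma bhZPerm_mul_bhZ {w : Equiv.Perm (Fin n)} {i : Fin (n - 1)} (h : w (lo i) < w (hi i)) :
    bhZPerm w * bhZ i = bhZPerm (w * simpleSwap i) := by
  rw [← bhZWord_eq_bhZPerm ((exists_isReducedExpr w).choose_spec.concat h), bhZPerm]
  simp [bhZWord]

/-- The elements `E_I z_w`. -/
def boxedFamily (n : ℕ) (x : Σ I : LinearSetPartition n, youngSubgroup (blockSizes I.1)) :
    BoxedHecke n :=
  bhEPart x.1.1 * bhZPerm x.2.1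

lemma mem_span_boxedFamily {J : Finset (Fin (n - 1))} {w : Equiv.Perm (Fin n)}
    (hw : ∀ a, colour J (w a) = colour J a) :
    (bhEProd J : BoxedHecke n) * bhZPerm w ∈
      Submodule.span GroundRing (Set.range (boxedFamily n)) := by
  refine Submodule.subset_span ⟨⟨ofJoined J, w, ?_⟩, ?_⟩
  · rw [mem_youngSubgroup_blockSizes, joined_ofJoined]
    exact hw
  · simp only [boxedFamily]
    rw [bhEPart_eq, joined_ofJoined]

lemma mul_bhE_mem_span {x : BoxedHecke n}
    (hx : x ∈ Submodule.span GroundRing (Set.range (boxedFamily n))) (i : Fin (n - 1)) :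
    x * bhE i ∈ Submodule.span GroundRing (Set.range (boxedFamily n)) := by
  induction hx using Submodule.span_induction with
  | mem x hx =>
    obtain ⟨⟨I, w, hw⟩, rfl⟩ := hx
    rw [mem_youngSubgroup_blockSizes] at hw
    simp only [boxedFamily]
    rw [Subalgebra.mem_center_iff.1 (bhE_mem_center i), bhEPart_eq, ← mul_assoc,
      bhE_mul_bhEProd]
    exact mem_span_boxedFamily fun a ↦ colour_eq_of_subset (Finset.subset_insert _ _) (hw a)
  | zero => rw [zero_mul]; exact Submodule.zero_mem _
  | add x y _ _ hx hy => rw [add_mul]; exact Submodule.add_mem _ hx hy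
  | smul c x _ hx => rw [smul_mul_assoc]; exact Submodule.smul_mem _ c hx

lemma mul_bhZ_mem_span {x : BoxedHecke n}
    (hx : x ∈ Submodule.span GroundRing (Set.range (boxedFamily n))) (i : Fin (n - 1)) :
    x * bhZ i ∈ Submodule.span GroundRing (Set.range (boxedFamily n)) := by
  induction hx using Submodule.span_induction with
  | mem x hx =>
    obtain ⟨⟨I, w, hw⟩, rfl⟩ := hx
    rw [mem_youngSubgroup_blockSizes] at hw
    simp only [boxedFamily]
    -- since `z_i = e_i z_i`, the set of ties may be enlarged by `i`
    have hJ : bhEPart I.1 * bhZPerm w * bhZ i =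
        (bhEProd (insert i (joined I.1)) : BoxedHecke n) * (bhZPerm w * bhZ i) := by
      rw [← bhE_mul_bhEProd, ← bhEPart_eq, ← Subalgebra.mem_center_iff.1 (bhE_mem_center i),
        mul_assoc (bhEPart I.1), mul_assoc (bhEPart I.1), ← mul_assoc (bhE i),
        ← Subalgebra.mem_center_iff.1 (bhE_mem_center i), mul_assoc (bhZPerm w), bhE_mul_bhZ]
    have hw' : ∀ a, colour (insert i (joined I.1)) (w a) = colour (insert i (joined I.1)) a :=
      fun a ↦ colour_eq_of_subset (Finset.subset_insert _ _) (hw a)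
    have hws : ∀ a, colour (insert i (joined I.1)) ((w * simpleSwap i) a) =
        colour (insert i (joined I.1)) a := fun a ↦ by
      rw [Equiv.Perm.mul_apply, hw', colour_simpleSwap (Finset.mem_insert_self _ _)]
    rw [hJ]
    rcases apply_lo_lt_or_gt w i with h | h
    · rw [bhZPerm_mul_bhZ h]
      exact mem_span_boxedFamily hws
    · have h1 := bhZPerm_mul_bhZ (w := w * simpleSwap i) (i := i)
        (by simpa [simpleSwap_lo, simpleSwap_hi] using h)
      rw [mul_assoc w, simpleSwap_mul_self, mul_one] at h1
      have h2 : bhZPerm w * bhZ i =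
          bhE i * bhZPerm (w * simpleSwap i) + (q - qInv) • bhZPerm w := by
        conv_lhs => rw [← h1]
        rw [mul_assoc, bhZ_mul_self, mul_add, mul_smul_comm, h1,
          Subalgebra.mem_center_iff.1 (bhE_mem_center i)]
      rw [h2, mul_add, ← mul_assoc, ← Subalgebra.mem_center_iff.1 (bhE_mem_center i) _ |>.symm,
        bhE_mul_bhEProd, Finset.insert_idem, mul_smul_comm]
      exact Submodule.add_mem _ (mem_span_boxedFamily hws)
        (Submodule.smul_mem _ _ (mem_span_boxedFamily hw'))
  | zero => rw [zero_mul]; exact Submodule.zero_mem _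
  | add x y _ _ hx hy => rw [add_mul]; exact Submodule.add_mem _ hx hy
  | smul c x _ hx => rw [smul_mul_assoc]; exact Submodule.smul_mem _ c hx

lemma span_boxedFamily (n : ℕ) :
    Submodule.span GroundRing (Set.range (boxedFamily n)) = ⊤ := by
  have key : ∀ x y : BoxedHecke n, y ∈ Submodule.span GroundRing (Set.range (boxedFamily n)) →
      y * x ∈ Submodule.span GroundRing (Set.range (boxedFamily n)) := fun x ↦ by
    induction x using boxedHecke_induction with
    | hc c =>
      intro y hy
      rw [← Algebra.commutes, ← Algebra.smul_def]
      exact Submodule.smul_mem _ c hy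
    | he i => exact fun y hy ↦ mul_bhE_mem_span hy i
    | hz i => exact fun y hy ↦ mul_bhZ_mem_span hy i
    | hmul a b ha hb =>
      intro y hy
      rw [← mul_assoc]
      exact hb _ (ha _ hy)
    | hadd a b ha hb =>
      intro y hy
      rw [mul_add]
      exact Submodule.add_mem _ (ha _ hy) (hb _ hy)
  refine Submodule.eq_top_iff'.2 fun x ↦ ?_
  have h1 := mem_span_boxedFamily (J := (∅ : Finset (Fin (n - 1)))) (w := 1) fun _ ↦ rfl
  rw [bhZPerm_one, mul_one, bhEProd, Finset.prod_empty] at h1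
  simpa using key x _ h1

/-! ### The elements `E_I z_w` act independently -/

/-- The representation of the tied-boxed Hecke algebra on the tensor space, by operators acting
on the right. -/
def bhRep (n r : ℕ) :
    BoxedHecke n →ₐ[GroundRing] (Module.End GroundRing (TensorSpace n r))ᵐᵒᵖ :=
  (btRep n r).comp (bhToBT n)

lemma bhRep_bhE (i : Fin (n - 1)) : bhRep n r (bhE i) = MulOpposite.op (tensorE r i) := by
  rw [bhRep, AlgHom.comp_apply, bhToBT_bhE, btRep_btE]

lemma bhRep_bhZ (i : Fin (n - 1)) : bhRep n r (bhZ i) =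
    MulOpposite.op (tensorE r i) * MulOpposite.op (tensorG r i) := by
  rw [bhRep, AlgHom.comp_apply, bhToBT_bhZ, map_mul, btRep_btE, btRep_btG]

lemma bhRep_mul_apply (x y : BoxedHecke n) (v : TensorSpace n r) :
    (bhRep n r (x * y)).unop v = (bhRep n r y).unop ((bhRep n r x).unop v) := by
  rw [map_mul, MulOpposite.unop_mul, Module.End.mul_apply]

/-- The basis tensor whose colours are constant exactly on the blocks given by `J` and whose
indices are decreasing. -/
def testIndex (hr : n ≤ r) (J : Finset (Fin (n - 1))) (a : Fin n) : Fin n × Fin r :=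
  (Fin.rev a, ⟨colour J a, (colour_lt J a).trans_le hr⟩)

lemma testIndex_injective (hr : n ≤ r) (J : Finset (Fin (n - 1))) :
    Function.Injective (testIndex hr J) := fun _ _ h ↦ Fin.rev_injective (congrArg Prod.fst h)

lemma bhRep_prod_bhE_apply (l : List (Fin (n - 1))) (f : Fin n → Fin n × Fin r) :
    (bhRep n r (l.map bhE).prod).unop (tensorBasis n r f) =
      if ∀ i ∈ l, (f (lo i)).2 = (f (hi i)).2 then tensorBasis n r f else 0 := by
  induction l with
  | nil => simp
  | cons i l ih =>
    rw [List.map_cons, List.prod_cons, bhRep_mul_apply, bhRep_bhE, MulOpposite.unop_op,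
      tensorE_apply, map_smul, ih, coeffTie]
    by_cases h : (f (lo i)).2 = (f (hi i)).2 <;> simp [h]

lemma bhRep_bhEPart_apply (hr : n ≤ r) (I : SetPartition n) (J : Finset (Fin (n - 1))) :
    (bhRep n r (bhEPart I)).unop (tensorBasis n r (testIndex hr J)) =
      if joined I ⊆ J then tensorBasis n r (testIndex hr J) else 0 := by
  rw [bhEPart, bhRep_prod_bhE_apply]
  congr 1
  simp [testIndex, colour_lo_eq_colour_hi, Finset.subset_iff, mem_joined]

/-- Along a reduced word the decreasing indices are sorted step by step, so every `z_i` acts by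
a mere exchange of two factors. -/
lemma bhRep_bhZWord_apply (hr : n ≤ r) (J : Finset (Fin (n - 1))) {w : Equiv.Perm (Fin n)}
    {l : List (Fin (n - 1))} (hl : IsReducedExpr w l) (hw : ∀ a, colour J (w a) = colour J a) :
    (bhRep n r (bhZWord l)).unop (tensorBasis n r (testIndex hr J)) =
      tensorBasis n r (testIndex hr J ∘ w) := by
  induction l using List.reverseRecOn generalizing w with
  | nil =>
    obtain rfl := hl.1
    simp [bhZWord]
  | append_singleton l i ih =>
    obtain ⟨hd, hl'⟩ := hl.of_concat
    have hiJ := mem_of_descent hw hd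
    have hw' : ∀ a, colour J ((w * simpleSwap i) a) = colour J a := fun a ↦ by
      rw [Equiv.Perm.mul_apply, hw, colour_simpleSwap hiJ]
    have hword : bhZWord (l ++ [i]) = bhZWord l * bhZ i := by simp [bhZWord]
    have htie : colour J (w (hi i)) = colour J (w (lo i)) := by
      rw [hw, hw, colour_lo_eq_colour_hi.2 hiJ]
    have hcomp : (testIndex hr J ∘ (w * simpleSwap i)) ∘ simpleSwap i = testIndex hr J ∘ w := by
      rw [Equiv.Perm.coe_mul, ← Function.comp_assoc, comp_simpleSwap_simpleSwap]
    rw [hword, bhRep_mul_apply, ih hl' hw', bhRep_bhZ, ← MulOpposite.op_mul,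
      MulOpposite.unop_op, Module.End.mul_apply, tensorE_apply, map_smul, tensorG_apply, hcomp]
    simp [simpleSwap_lo, simpleSwap_hi, testIndex, coeffTie, coeffStay, coeffSwap, htie, hd.ne,
      hd.not_gt]

lemma bhRep_boxedFamily_apply (hr : n ≤ r) (J : Finset (Fin (n - 1)))
    (x : Σ I : LinearSetPartition n, youngSubgroup (blockSizes I.1)) :
    (bhRep n r (boxedFamily n x)).unop (tensorBasis n r (testIndex hr J)) =
      if joined x.1.1 ⊆ J then tensorBasis n r (testIndex hr J ∘ x.2.1) else 0 := by
  obtain ⟨I, w, hw⟩ := x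
  rw [mem_youngSubgroup_blockSizes] at hw
  simp only [boxedFamily]
  rw [bhRep_mul_apply, bhRep_bhEPart_apply]
  split_ifs with h
  · exact bhRep_bhZWord_apply hr J (exists_isReducedExpr w).choose_spec
      fun a ↦ colour_eq_of_subset h (hw a)
  · rw [map_zero]

/-- Only the `E_I` with `I` finer than the partition given by `J` survive on the test tensor of
`J`, which allows an induction on the number of ties. -/
lemma eq_zero_of_bhRep_sum_eq_zero (hr : n ≤ r)
    {g : (Σ I : LinearSetPartition n, youngSubgroup (blockSizes I.1)) →₀ GroundRing}
    (hg : bhRep n r (Finsupp.linearCombination GroundRing (boxedFamily n) g) = 0) : g = 0 := by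
  suffices h : ∀ k, ∀ x, (joined x.1.1).card = k → g x = 0 from Finsupp.ext fun x ↦ h _ x rfl
  intro k
  induction k using Nat.strong_induction_on with
  | _ k ih =>
    intro x hx
    by_contra hgx
    -- the coefficient at the test tensor of `x` permuted by the permutation of `x`
    let L : BoxedHecke n →ₗ[GroundRing] GroundRing :=
      (tensorBasis n r).coord (testIndex hr (joined x.1.1) ∘ x.2.1) ∘ₗ
        LinearMap.applyₗ (tensorBasis n r (testIndex hr (joined x.1.1))) ∘ₗ
        (MulOpposite.opLinearEquiv GroundRing).symm.toLinearMap ∘ₗ (bhRep n r).toLinearMap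
    have hL : ∀ y, L (boxedFamily n y) = (tensorBasis n r).repr
        (if joined y.1.1 ⊆ joined x.1.1 then
          tensorBasis n r (testIndex hr (joined x.1.1) ∘ y.2.1) else 0)
        (testIndex hr (joined x.1.1) ∘ x.2.1) := fun y ↦ by
      rw [← bhRep_boxedFamily_apply]
      rfl
    have h0 : L (Finsupp.linearCombination GroundRing (boxedFamily n) g) = 0 := by
      have hL' : L (Finsupp.linearCombination GroundRing (boxedFamily n) g) =
        (tensorBasis n r).coord (testIndex hr (joined x.1.1) ∘ x.2.1)
          ((bhRep n r (Finsupp.linearCombination GroundRing (boxedFamily n) g)).unop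
            (tensorBasis n r (testIndex hr (joined x.1.1)))) := rfl
      rw [hL', hg, MulOpposite.unop_zero, LinearMap.zero_apply, map_zero]
    rw [Finsupp.linearCombination_apply, Finsupp.sum, map_sum] at h0
    simp only [map_smul, hL] at h0
    rw [Finset.sum_eq_single x] at h0
    · rw [if_pos (Finset.Subset.refl _), Module.Basis.repr_self, Finsupp.single_eq_same,
        smul_eq_mul, mul_one] at h0
      exact hgx h0
    · intro y _ hyx
      by_cases hsub : joined y.1.1 ⊆ joined x.1.1
      · by_cases heq : joined y.1.1 = joined x.1.1
        · rw [if_pos hsub, Module.Basis.repr_self, Finsupp.single_apply, if_neg, smul_zero]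
          intro hcomp
          obtain ⟨I, w⟩ := x
          obtain ⟨I', w'⟩ := y
          obtain rfl : I' = I := joined_injective heq
          refine hyx ?_
          congr 1
          refine Subtype.ext (Equiv.ext fun a ↦ testIndex_injective hr _ (congrFun hcomp a))
        · rw [ih _ (hx ▸ Finset.card_lt_card (hsub.ssubset_of_ne heq)) y rfl, zero_smul]
      · rw [if_neg hsub, map_zero, Finsupp.zero_apply, smul_zero]
    · intro h
      exact absurd (Finsupp.notMem_support_iff.1 h) hgx

lemma linearIndependent_boxedFamily (n : ℕ) :
    LinearIndependent GroundRing (boxedFamily n) := by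
  intro g g' h
  refine sub_eq_zero.1 (eq_zero_of_bhRep_sum_eq_zero (r := n) le_rfl ?_)
  have hneg : ∀ y : BoxedHecke n, y + (-1 : GroundRing) • y = 0 := fun y ↦ by
    calc y + (-1 : GroundRing) • y = (1 : GroundRing) • y + (-1 : GroundRing) • y := by
          rw [one_smul]
      _ = 0 := by rw [← add_smul, add_neg_cancel, zero_smul]
  have hsub : g - g' = g + (-1 : GroundRing) • g' := by rw [neg_one_smul, sub_eq_add_neg]
  rw [hsub, map_add, map_smul, h, hneg, map_zero]

/-- The basis of `bH_n(q)` formed by the elements `E_I z_w`. -/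
def boxedBasis (n : ℕ) :
    Module.Basis (Σ I : LinearSetPartition n, youngSubgroup (blockSizes I.1)) GroundRing
      (BoxedHecke n) :=
  Module.Basis.mk (linearIndependent_boxedFamily n) (span_boxedFamily n).ge

lemma bhRep_injective (hr : n ≤ r) : Function.Injective (bhRep n r) := by
  rw [injective_iff_map_eq_zero]
  intro x hx
  have h : Finsupp.linearCombination GroundRing (boxedFamily n) ((boxedBasis n).repr x) = x := by
    rw [← Module.Basis.coe_mk (linearIndependent_boxedFamily n) (span_boxedFamily n).ge]
    exact (boxedBasis n).linearCombination_repr x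
  rw [← h] at hx ⊢
  rw [eq_zero_of_bhRep_sum_eq_zero hr hx, map_zero]

lemma bhToBT_injective (n : ℕ) : Function.Injective (bhToBT n) := by
  have h := bhRep_injective (n := n) le_rfl
  rw [bhRep, AlgHom.coe_comp] at h
  exact h.of_comp

end TiedBoxed

end

theorem theorem5p4 (n : ℕ) (hn : 0 < n) :
    -- the elements `z_w` do not depend on the chosen reduced expressions
    (∀ (w : Equiv.Perm (Fin n)) (l : List (Fin (n - 1))), TiedBoxed.IsReducedExpr w l →
      TiedBoxed.bhZWord l = TiedBoxed.bhZPerm w) ∧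
    -- the elements `E_I z_w` form a basis
    (∃ b : Module.Basis
        (Σ I : TiedBoxed.LinearSetPartition n,
          TiedBoxed.youngSubgroup (TiedBoxed.blockSizes I.1))
        TiedBoxed.GroundRing (TiedBoxed.BoxedHecke n),
      ∀ (I : TiedBoxed.LinearSetPartition n)
        (w : TiedBoxed.youngSubgroup (TiedBoxed.blockSizes I.1)),
        b ⟨I, w⟩ = TiedBoxed.bhEPart I.1 * TiedBoxed.bhZPerm w.1) ∧
    -- the dimension formula
    (Module.Finite TiedBoxed.GroundRing (TiedBoxed.BoxedHecke n) ∧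
      Module.finrank TiedBoxed.GroundRing (TiedBoxed.BoxedHecke n) =
        ∑ μ : Composition n, (μ.blocks.map Nat.factorial).prod) ∧
    -- the embedding into the algebra of braids and ties
    (∃ ι : TiedBoxed.BoxedHecke n →ₐ[TiedBoxed.GroundRing] TiedBoxed.BraidsTies n,
      (∀ i, ι (TiedBoxed.bhE i) = TiedBoxed.btE i) ∧
      (∀ i, ι (TiedBoxed.bhZ i) = TiedBoxed.btE i * TiedBoxed.btG i) ∧
      Function.Injective ι) ∧
    -- the faithful representation by operators acting on the right of the tensor space
    (∀ r : ℕ, n ≤ r →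
      ∃ φ : TiedBoxed.BoxedHecke n →ₐ[TiedBoxed.GroundRing]
          (Module.End TiedBoxed.GroundRing (TiedBoxed.TensorSpace n r))ᵐᵒᵖ,
        (∀ i, φ (TiedBoxed.bhE i) =
          MulOpposite.op (TiedBoxed.actAt i (TiedBoxed.opE n r))) ∧
        (∀ i, φ (TiedBoxed.bhZ i) =
          MulOpposite.op (TiedBoxed.actAt i (TiedBoxed.opE n r)) *
            MulOpposite.op (TiedBoxed.actAt i (TiedBoxed.opG n r))) ∧
        Function.Injective φ) := by
  refine ⟨fun w l hl ↦ TiedBoxed.bhZWord_eq_bhZPerm hl, ⟨TiedBoxed.boxedBasis n, fun I w ↦ ?_⟩,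
    ⟨Module.Finite.of_basis (TiedBoxed.boxedBasis n), ?_⟩,
    ⟨TiedBoxed.bhToBT n, TiedBoxed.bhToBT_bhE, TiedBoxed.bhToBT_bhZ,
      TiedBoxed.bhToBT_injective n⟩,
    fun r hr ↦ ⟨TiedBoxed.bhRep n r, TiedBoxed.bhRep_bhE, TiedBoxed.bhRep_bhZ,
      TiedBoxed.bhRep_injective hr⟩⟩
  · rw [TiedBoxed.boxedBasis, Module.Basis.mk_apply, TiedBoxed.boxedFamily]
  · rw [Module.finrank_eq_nat_card_basis (TiedBoxed.boxedBasis n),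
      TiedBoxed.card_sigma_youngSubgroup]
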